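/- Let $p$ be a prime number and $G$ a finite group. Let $G\text{-}\mathrm{sets}$ be the category of finite left $G$-sets, equipped with the sipp topology: a family of $G$-maps $\{\alpha_i:U_i\to X\}_{i\in I}$ is a covering if for every $x\in X$ there are $i\in I$ and $u\in U_i$ with $\alpha_i(u)=x$ and $[\mathrm{St}_G(x):\mathrm{St}_G(u)]$ prime to $p$; a single $G$-map $\alpha:U\to X$ is a cover if $\{\alpha\}$ is a covering. For a $G$-set $X$ let $G\ltimes X$ be its action groupoid (objects: the elements of $X$; morphisms $x\to x'$: the $g\in G$ with $gx=x'$). For a category $\mathcal A$ let $\mathrm{Rep}(X)=\mathcal A^{G\ltimes X}$ be the category of functors $G\ltimes X\to\mathcal A$, and for a $G$-map $\alpha:Y\to X$ let $\alpha^*:\mathrm{Rep}(X)\to\mathrm{Rep}(Y)$ be precomposition with $G\ltimes\alpha$. If $\mathcal A$ is abelian, let $\mathrm D(\mathrm{Rep}(X))$ be the (unbounded) derived category of $\mathrm{Rep}(X)$, with the functors induced degreewise by $\alpha^*$. If $\mathcal A=k\text{-}\mathrm{Vect}$ is the category of all vector spaces over a field $k$, let $\mathrm{StRep}(X)$ be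 the stable category, with the same objects as $\mathrm{Rep}(X)$ and with two morphisms identified when their difference factors through a projective object, with the functors induced by $\alpha^*$. A strict functor $\mathcal D:(G\text{-}\mathrm{sets})^{\mathrm{op}}\to\mathrm{Cat}$ is a strict stack for the sipp topology if for every sipp cover $\alpha:U\to X$ the functor $\mathcal D(X)\to\mathrm{Desc}_{\mathcal D}(\alpha)$, $V\mapsto(\alpha^*V,\mathrm{id})$, $f\mapsto\alpha^*f$, is an equivalence of categories. Here the objects of $\mathrm{Desc}_{\mathcal D}(\alpha)$ are the pairs $(W,s)$ of an object $W$ of $\mathcal D(U)$ and an isomorphism $s:\mathrm{pr}_2^*W\to\mathrm{pr}_1^*W$ in $\mathcal D(U\times_XU)$ such that $\mathrm{pr}_{13}^*s=\mathrm{pr}_{12}^*s\circ\mathrm{pr}_{23}^*s$ in $\mathcal D(U\times_XU\times_XU)$, and the morphisms $(W,s)\to(W',s')$ are the morphisms $f:W\to W'$ in $\mathcal D(U)$ with $\mathrm{pr}_1^*f\circ s=s'\circ\mathrm{pr}_2^*f$. Then the following are strict functors from $(G\text{-}\mathrm{sets})^{\mathrm{op}}$ to the category of additive categories and additive functors, and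 they are strict stacks for the sipp topology: (a) $\mathrm{Rep}(-)=\mathcal A^{G\ltimes-}$, for every idempotent-complete additive $\mathbb Z_{(p)}$-linear category $\mathcal A$; (b) $\mathrm D(\mathrm{Rep}(-))$, for every abelian $\mathbb Z_{(p)}$-linear category $\mathcal A$; (c) $\mathrm{StRep}(-)$, for $\mathcal A=k\text{-}\mathrm{Vect}$ with $k$ a field of characteristic $p$. -/

import Mathlib

namespace Sipp

open CategoryTheory Limits Opposite

universe w v u t

/-- The category of finite left `G`-sets and `G`-equivariant maps. -/
abbrev GSets (G : Type t) [Group G] := Action FintypeCat.{w} G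

section top

/-- The ideal of `ℤ` generated by a prime number is prime. -/
instance isPrime_span (p : ℕ) [Fact p.Prime] : (Ideal.span {(p : ℤ)}).IsPrime :=
  (Ideal.span_singleton_prime (by exact_mod_cast (Fact.out : p.Prime).ne_zero)).2
    (Nat.prime_iff_prime_int.1 Fact.out)

/-- The ring `ℤ_(p)`, i.e. the localization of `ℤ` at the prime ideal `(p)`. -/
abbrev ZLoc (p : ℕ) [Fact p.Prime] := Localization.AtPrime (Ideal.span {(p : ℤ)})

variable {G : Type t} [Group G]

theorem hom_smul {X Y : GSets.{w} G} (f : X ⟶ Y) (g : G) (x : X.V) :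
    f.hom (g • x) = g • f.hom x :=
  ConcreteCategory.congr_hom (f.comm g) x

theorem stabilizer_le {X Y : GSets.{w} G} (f : X ⟶ Y) (x : X.V) :
    MulAction.stabilizer G x ≤ MulAction.stabilizer G (f.hom x) := fun g hg => by
  rw [MulAction.mem_stabilizer_iff] at hg ⊢
  rw [← hom_smul, hg]

theorem exists_pullback {X Y Z : GSets.{w} G} (f : X ⟶ Z) (g : Y ⟶ Z) (x : X.V) (y : Y.V)
    (h : f.hom x = g.hom y) :
    ∃ z : (pullback f g).V, (pullback.fst f g).hom z = x ∧ (pullback.snd f g).hom z = y :=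
  Types.exists_of_isPullback
    ((IsPullback.of_hasPullback f g).map (Action.forget FintypeCat G ⋙ FintypeCat.incl)) x y h

theorem pullback_ext {X Y Z : GSets.{w} G} (f : X ⟶ Z) (g : Y ⟶ Z) (z z' : (pullback f g).V)
    (h₁ : (pullback.fst f g).hom z = (pullback.fst f g).hom z')
    (h₂ : (pullback.snd f g).hom z = (pullback.snd f g).hom z') : z = z' :=
  Types.ext_of_isPullback
    ((IsPullback.of_hasPullback f g).map (Action.forget FintypeCat G ⋙ FintypeCat.incl)) h₁ h₂

/-- A family `S` of `G`-maps to `X` is a sipp-covering if every `x : X` is the image of some `u`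
under a member of the family, with stabilizer of index `[St(x) : St(u)]` prime to `p`. -/
def IsSippCovering (p : ℕ) {X : GSets.{w} G} (S : Presieve X) : Prop :=
  ∀ x : X.V, ∃ (U : GSets.{w} G) (α : U ⟶ X), S α ∧ ∃ u : U.V, α.hom u = x ∧
    ((MulAction.stabilizer G u).relIndex (MulAction.stabilizer G x)).Coprime p

/-- If the index of the stabilizer of `u` in `H` is prime to `p` and `K ≤ H`, then some `H`-translate
of `u` has a stabilizer of index prime to `p` in `K`. -/
theorem exists_coprime (p : ℕ) [Fact p.Prime] {U : Type*} [Finite G] [MulAction G U] (u : U)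
    (H K : Subgroup G) (hKH : K ≤ H) (hc : ((MulAction.stabilizer G u).relIndex H).Coprime p) :
    ∃ h ∈ H, ((MulAction.stabilizer G (h • u)).relIndex K).Coprime p := by
  obtain ⟨Q⟩ := (inferInstance : Nonempty (Sylow p K))
  let Q' : Subgroup H := (Q : Subgroup K).map (Subgroup.inclusion hKH)
  have hQ' : IsPGroup p Q' := Q.2.map _
  have hs : MulAction.stabilizer H u = (MulAction.stabilizer G u).subgroupOf H := by
    ext g; rfl
  have hcard : ¬ p ∣ Nat.card (MulAction.orbit H u) := by
    have h := MulAction.index_stabilizer H u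
    rw [hs] at h
    rw [Nat.card_coe_set_eq, ← h]
    exact (Nat.Prime.coprime_iff_not_dvd Fact.out).1 hc.symm
  obtain ⟨⟨_, h, rfl⟩, hv⟩ := hQ'.nonempty_fixed_point_of_prime_not_dvd_card _ hcard
  refine ⟨h.1, h.2, Nat.Coprime.coprime_dvd_left ?_
    ((Nat.Prime.coprime_iff_not_dvd Fact.out).2 Q.not_dvd_index).symm⟩
  refine Subgroup.index_dvd_of_le fun q hq => ?_
  have := congrArg Subtype.val (hv ⟨_, Subgroup.mem_map_of_mem _ hq⟩)
  exact this

/-- The sipp topology on finite `G`-sets (more precisely, the basis given by the sipp-coverings). -/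
def sippTopology (G : Type t) [Group G] [Finite G] (p : ℕ) [Fact p.Prime] :
    Pretopology (GSets.{w} G) where
  coverings _ := {S | IsSippCovering p S}
  has_isos X Y f _ x := by
    have e : f.hom ((inv f).hom x) = x :=
      ConcreteCategory.congr_hom (congrArg Action.Hom.hom (IsIso.inv_hom_id f)) x
    refine ⟨Y, f, ⟨⟩, (inv f).hom x, e, ?_⟩
    have h : MulAction.stabilizer G ((inv f).hom x) = MulAction.stabilizer G x :=
      le_antisymm ((stabilizer_le f _).trans_eq (by rw [e])) (stabilizer_le (inv f) x)
    rw [h, Subgroup.relIndex_self]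
    exact Nat.coprime_one_left p
  pullbacks X Y f S hS y := by
    obtain ⟨U, α, hα, u, hu, hc⟩ := hS (f.hom y)
    obtain ⟨h, hh, hc'⟩ := exists_coprime p u _ _ (stabilizer_le f y) hc
    obtain ⟨z, hz₁, hz₂⟩ := exists_pullback α f (h • u) y (by
      rw [hom_smul, hu]; exact hh)
    refine ⟨_, pullback.snd α f, Presieve.pullbackArrows.mk _ _ hα, z, hz₂, ?_⟩
    have hz : MulAction.stabilizer G z =
        MulAction.stabilizer G (h • u) ⊓ MulAction.stabilizer G y := by
      refine le_antisymm (le_inf (hz₁ ▸ stabilizer_le _ z) (hz₂ ▸ stabilizer_le _ z)) ?_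
      rintro g ⟨h₁, h₂⟩
      refine pullback_ext _ _ _ _ ?_ ?_
      · rw [hom_smul, hz₁]; exact h₁
      · rw [hom_smul, hz₂]; exact h₂
    rw [hz, Subgroup.inf_relIndex_right]
    exact hc'
  transitive X S T hS hT x := by
    obtain ⟨U, α, hα, u, rfl, hc⟩ := hS x
    obtain ⟨V, β, hβ, v, rfl, hc'⟩ := hT α hα u
    refine ⟨V, β ≫ α, ⟨_, β, α, hα, hβ, rfl⟩, v, rfl, ?_⟩
    rw [← Subgroup.relIndex_mul_relIndex _ _ _ (stabilizer_le β v) (stabilizer_le α _)]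
    exact Nat.Coprime.mul_left hc' hc

end top
section descent
variable {C : Type u} [Category.{v} C] (D : Cᵒᵖ ⥤ Cat.{w, t})

/-- The restriction functor `f^* : D(X) ⥤ D(Y)` of a presheaf of categories along `f : Y ⟶ X`. -/
abbrev res {X Y : C} (f : Y ⟶ X) : D.obj (op X) ⥤ D.obj (op Y) := (D.map f.op).toFunctor

theorem res_obj_eq {X Y Z : C} {g : Z ⟶ Y} {f : Y ⟶ X} {h : Z ⟶ X} (w : g ≫ f = h)
    (V : D.obj (op X)) : (res D g).obj ((res D f).obj V) = (res D h).obj V := by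
  subst w
  simp [res]

theorem res_map_eq {X Y Z : C} {g : Z ⟶ Y} {f : Y ⟶ X} {h : Z ⟶ X} (w : g ≫ f = h)
    {V V' : D.obj (op X)} (φ : V ⟶ V') : (res D g).map ((res D f).map φ) =
      eqToHom (res_obj_eq D w V) ≫ (res D h).map φ ≫ eqToHom (res_obj_eq D w V').symm := by
  subst w
  simp only [res, op_comp]
  rw [Functor.congr_hom (congrArg Cat.Hom.toFunctor (D.map_comp f.op g.op)) φ]
  simp

/-- The morphism `g^* φ` for a morphism `φ : f₁^* V₁ ⟶ f₂^* V₂`, seen as a morphism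
`h₁^* V₁ ⟶ h₂^* V₂` through the equalities of functors `g^* f₁^* = h₁^*` and `g^* f₂^* = h₂^*`. -/
def pullHom {X₁ X₂ Y Z : C} {f₁ : Y ⟶ X₁} {f₂ : Y ⟶ X₂} {V₁ : D.obj (op X₁)} {V₂ : D.obj (op X₂)}
    (φ : (res D f₁).obj V₁ ⟶ (res D f₂).obj V₂) (g : Z ⟶ Y) {h₁ : Z ⟶ X₁} {h₂ : Z ⟶ X₂}
    (w₁ : g ≫ f₁ = h₁) (w₂ : g ≫ f₂ = h₂) :
    (res D h₁).obj V₁ ⟶ (res D h₂).obj V₂ :=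
  eqToHom (res_obj_eq D w₁ V₁).symm ≫ (res D g).map φ ≫ eqToHom (res_obj_eq D w₂ V₂)

section
variable [HasPullbacks C] {X U : C} (α : U ⟶ X)

/-- `U ×_X U`. -/
noncomputable abbrev dbl : C := pullback α α
/-- The first projection `U ×_X U ⟶ U`. -/
noncomputable abbrev pr₁ : dbl α ⟶ U := pullback.fst α α
/-- The second projection `U ×_X U ⟶ U`. -/
noncomputable abbrev pr₂ : dbl α ⟶ U := pullback.snd α α
/-- `U ×_X U ×_X U`, as the fibre product `(U ×_X U) ×_U (U ×_X U)` along `pr₂` and `pr₁`. -/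
noncomputable abbrev tpl : C := pullback (pr₂ α) (pr₁ α)
/-- The projection of the triple fibre product to the factors 1 and 2. -/
noncomputable abbrev pr₁₂ : tpl α ⟶ dbl α := pullback.fst (pr₂ α) (pr₁ α)
/-- The projection of the triple fibre product to the factors 2 and 3. -/
noncomputable abbrev pr₂₃ : tpl α ⟶ dbl α := pullback.snd (pr₂ α) (pr₁ α)
/-- The projection of the triple fibre product to the factors 1 and 3. -/
noncomputable abbrev pr₁₃ : tpl α ⟶ dbl α :=
  pullback.lift (pr₁₂ α ≫ pr₁ α) (pr₂₃ α ≫ pr₂ α) (by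
    have h : pr₁₂ α ≫ pr₂ α = pr₂₃ α ≫ pr₁ α := pullback.condition
    have h' : pr₁ α ≫ α = pr₂ α ≫ α := pullback.condition
    rw [Category.assoc, Category.assoc, h', ← Category.assoc, h, Category.assoc, h'])

/-- A (strict) descent datum for the presheaf of categories `D` and the cover `α : U ⟶ X`: an
object `W` of `D(U)` and a gluing isomorphism `s : pr₂^* W ≅ pr₁^* W` in `D(U ×_X U)` with
`pr₁₃^* s = pr₁₂^* s ∘ pr₂₃^* s` in `D(U ×_X U ×_X U)`. -/
structure DescentDatum where
  /-- the object over `U` -/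
  obj : D.obj (op U)
  /-- the gluing isomorphism -/
  glue : (res D (pr₂ α)).obj obj ≅ (res D (pr₁ α)).obj obj
  cocycle :
    pullHom D glue.hom (pr₁₃ α) (h₁ := pr₂₃ α ≫ pr₂ α) (h₂ := pr₁₂ α ≫ pr₁ α)
        (pullback.lift_snd _ _ _) (pullback.lift_fst _ _ _) =
      pullHom D glue.hom (pr₂₃ α) (h₁ := pr₂₃ α ≫ pr₂ α) (h₂ := pr₁₂ α ≫ pr₂ α)
          rfl pullback.condition.symm ≫
        pullHom D glue.hom (pr₁₂ α) (h₁ := pr₁₂ α ≫ pr₂ α) (h₂ := pr₁₂ α ≫ pr₁ α) rfl rfl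

variable {D α}

/-- A morphism of descent data: a morphism `f : W ⟶ W'` in `D(U)` such that
`pr₁^* f ∘ s = s' ∘ pr₂^* f`. -/
@[ext]
structure DescentDatum.Hom (W W' : DescentDatum D α) where
  /-- the underlying morphism over `U` -/
  hom : W.obj ⟶ W'.obj
  comm : W.glue.hom ≫ (res D (pr₁ α)).map hom = (res D (pr₂ α)).map hom ≫ W'.glue.hom

/-- The descent category of the cover `α`. -/
instance : Category (DescentDatum D α) where
  Hom := DescentDatum.Hom
  id W := ⟨𝟙 _, by simp⟩
  comp f g := ⟨f.hom ≫ g.hom, by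
    rw [Functor.map_comp, Functor.map_comp, reassoc_of% f.comm, g.comm, Category.assoc]⟩
  id_comp f := DescentDatum.Hom.ext (Category.id_comp _)
  comp_id f := DescentDatum.Hom.ext (Category.comp_id _)
  assoc f g h := DescentDatum.Hom.ext (Category.assoc _ _ _)

variable (D α)

/-- The comparison functor `Q` from `D(X)` to the descent category of `α : U ⟶ X`: it maps `V` to
`α^* V` with gluing isomorphism the identity of `pr₂^* α^* V = pr₁^* α^* V`. -/
noncomputable def comparison : D.obj (op X) ⥤ DescentDatum D α where
  obj V :=
    { obj := (res D α).obj V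
      glue := eqToIso ((res_obj_eq D pullback.condition.symm V).trans (res_obj_eq D rfl V).symm)
      cocycle := by simp [pullHom, eqToHom_map] }
  map {V V'} f :=
    { hom := (res D α).map f
      comm := by
        rw [res_map_eq D (g := pr₁ α) (f := α) rfl f,
          res_map_eq D (g := pr₂ α) (f := α) pullback.condition.symm f]
        simp }
  map_id V := DescentDatum.Hom.ext ((res D α).map_id V)
  map_comp f g := DescentDatum.Hom.ext ((res D α).map_comp f g)

end

/-- A presheaf of categories `D` on a site (a category with pullbacks and a basis `K` of a
topology) is a strict stack if for every cover `α : U ⟶ X` the comparison functor from `D(X)` to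
the descent category of `α` is an equivalence. -/
def IsStrictStack [HasPullbacks C] (K : Pretopology C) : Prop :=
  ∀ ⦃X U : C⦄ (α : U ⟶ X), Presieve.singleton α ∈ K X → (comparison D α).IsEquivalence

/-- `D` takes values in additive categories and additive functors. -/
def IsAdditivePresheaf : Prop :=
  ∃ _ : ∀ X : C, Preadditive (D.obj (op X)),
    (∀ X : C, HasFiniteProducts (D.obj (op X))) ∧
    ∀ ⦃X Y : C⦄ (f : Y ⟶ X), (res D f).Additive

end descent

section rep
variable {G : Type t} [Group G]

/-- The functor `G ⋉ α : G ⋉ X ⥤ G ⋉ Y` between action groupoids induced by a `G`-map `α`. -/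
def actionMap {X Y : GSets.{w} G} (α : X ⟶ Y) : ActionCategory G X.V ⥤ ActionCategory G Y.V where
  obj x := ⟨x.1, α.hom x.2⟩
  map {x _} g := ⟨g.1, (hom_smul α g.1 x.2).symm.trans (congrArg _ g.2)⟩

/-- The category `Rep(X)` of representations in `A` of the `G`-set `X`. -/
abbrev RepCat (A : Type u) [Category.{v} A] (X : GSets.{w} G) := ActionCategory G X.V ⥤ A

/-- The restriction functor `α^* : Rep(X) ⥤ Rep(Y)` along a `G`-map `α : Y ⟶ X`. -/
abbrev repRes (A : Type u) [Category.{v} A] {X Y : GSets.{w} G} (α : Y ⟶ X) :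
    RepCat A X ⥤ RepCat A Y :=
  (Functor.whiskeringLeft _ _ A).obj (actionMap α)

/-- The presheaf of categories `X ↦ Rep(X)`. -/
def Rep (G : Type t) [Group G] (A : Type u) [Category.{v} A] :
    (GSets.{w} G)ᵒᵖ ⥤ Cat.{max w v, max (max u v w) t} where
  obj X := Cat.of (RepCat A X.unop)
  map α := (repRes A α.unop).toCatHom
  map_id _ := rfl
  map_comp _ _ := rfl

end rep

section derived

/-- The derived category of an abelian category `C`: the complexes in `C`, with the
quasi-isomorphisms formally inverted. -/
abbrev Der (C : Type u) [Category.{v} C] [Abelian C] :=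
  (HomologicalComplex.quasiIso C (ComplexShape.up ℤ)).Localization

/-- The functor between derived categories given by applying an exact functor degreewise. -/
noncomputable def Der.map {C C' : Type*} [Category* C] [Category* C'] [Abelian C] [Abelian C']
    (F : C ⥤ C') [F.Additive] [F.PreservesHomology] : Der C ⥤ Der C' :=
  Localization.Construction.lift
    (F.mapHomologicalComplex (ComplexShape.up ℤ) ⋙ MorphismProperty.Q _)
    (fun _ _ f (_ : QuasiIso f) => MorphismProperty.Q_inverts _ _
      (HomologicalComplex.quasiIso_map_of_preservesHomology f F))

instance repRes_preservesHomology {G : Type t} [Group G] (A : Type u) [Category.{v} A]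
    [Abelian A] {X Y : GSets.{w} G} (α : Y ⟶ X) : (repRes A α).PreservesHomology :=
  have : PreservesFiniteLimits (repRes A α) := ⟨fun _ ↦ inferInstance⟩
  have : PreservesFiniteColimits (repRes A α) := ⟨fun _ ↦ inferInstance⟩
  inferInstance

theorem Der.fac {C C' : Type*} [Category* C] [Category* C'] [Abelian C] [Abelian C']
    (F : C ⥤ C') [F.Additive] [F.PreservesHomology] :
    MorphismProperty.Q _ ⋙ Der.map F =
      F.mapHomologicalComplex (ComplexShape.up ℤ) ⋙ MorphismProperty.Q _ :=
  Localization.Construction.fac _ _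

theorem Der.map_id (C : Type*) [Category* C] [Abelian C] : Der.map (𝟭 C) = 𝟭 (Der C) :=
  Localization.Construction.uniq _ _ (Localization.Construction.fac _ _)

theorem Der.map_comp {C C' C'' : Type*} [Category* C] [Category* C'] [Category* C'']
    [Abelian C] [Abelian C'] [Abelian C''] (F : C ⥤ C') (F' : C' ⥤ C'')
    [F.Additive] [F.PreservesHomology] [F'.Additive] [F'.PreservesHomology]
    [(F ⋙ F').PreservesHomology] : Der.map (F ⋙ F') = Der.map F ⋙ Der.map F' := by
  refine Localization.Construction.uniq _ _ ((Der.fac _).trans ?_)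
  rw [← Functor.assoc, Der.fac, Functor.assoc, Der.fac]
  rfl

/-- The presheaf of categories `X ↦ D(Rep(X))`. -/
noncomputable def DerRep (G : Type t) [Group G] (A : Type u) [Category.{v} A] [Abelian A] :
    (GSets.{w} G)ᵒᵖ ⥤ Cat.{max u v w t, max u v w t} where
  obj X := Cat.of (Der (RepCat A X.unop))
  map α := (Der.map (repRes A α.unop)).toCatHom
  map_id X := congrArg Functor.toCatHom (Der.map_id (RepCat A X.unop))
  map_comp f g := congrArg Functor.toCatHom (Der.map_comp (repRes A f.unop) (repRes A g.unop))

end derived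

section stable

/-- Two morphisms are stably equal if their difference factors through a projective object. -/
def stableRel (C : Type u) [Category.{v} C] [Preadditive C] : HomRel C := fun X Y f g =>
  ∃ (P : C) (_ : Projective P) (i : X ⟶ P) (q : P ⟶ Y), f - g = i ≫ q

/-- The stable category of `C`, i.e. its additive quotient by the projective objects. -/
abbrev Stab (C : Type u) [Category.{v} C] [Preadditive C] :=
  CategoryTheory.Quotient (stableRel C)

/-- The functor between stable categories induced by an additive functor that preserves
projective objects. -/
def Stab.map {C C' : Type*} [Category* C] [Category* C'] [Preadditive C] [Preadditive C']
    (F : C ⥤ C') [F.Additive] (hF : ∀ P : C, Projective P → Projective (F.obj P)) :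
    Stab C ⥤ Stab C' :=
  CategoryTheory.Quotient.lift _ (F ⋙ CategoryTheory.Quotient.functor _)
    fun _ _ _ _ ⟨P, hP, i, q, h⟩ =>
      CategoryTheory.Quotient.sound _ ⟨F.obj P, hF P hP, F.map i, F.map q, by
        rw [← F.map_sub, h, F.map_comp]⟩

variable {G : Type t} [Group G] {A : Type u} [Category.{v} A] [Abelian A]

/-! Restriction along a `G`-map `α : Y ⟶ X` preserves projective objects, because it has an exact
right adjoint, `(α_* N)_x = ⨁_{α y = x} N_y`. -/

section coind
variable {X Y : GSets.{w} G} (α : Y ⟶ X)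

/-- An element of a `G`-set, as an object of the action groupoid. -/
abbrev pt (y : Y.V) : ActionCategory G Y.V := ⟨(), y⟩

/-- The morphism of the action groupoid given by an element of `G`. -/
abbrev arr {y y' : ActionCategory G Y.V} (g : G) (h : g • y.back = y'.back) : y ⟶ y' := ⟨g, h⟩

/-- The fibre of `α` over `x`. -/
abbrev Fib (x : ActionCategory G X.V) := {y : Y.V // α.hom y = x.back}

instance (x : ActionCategory G X.V) : Finite (Fib α x) :=
  inferInstanceAs (Finite {y : Y.V // α.hom y = x.back})

theorem inv_mem_fib {x x' : ActionCategory G X.V} (g : x ⟶ x') (y : Fib α x') :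
    α.hom (g.1⁻¹ • y.1) = x.back := by
  rw [hom_smul, y.2, inv_smul_eq_iff]
  exact g.2.symm

variable (N : RepCat A Y)

instance (x : ActionCategory G X.V) : HasBiproduct fun y : Fib α x => N.obj (pt y.1) :=
  haveI := Abelian.hasFiniteBiproducts (C := A)
  inferInstance

/-- The action of a morphism of the action groupoid of `X` on `α_* N`. -/
noncomputable def coindMap {x x' : ActionCategory G X.V} (g : x ⟶ x') :
    (⨁ fun y : Fib α x => N.obj (pt y.1)) ⟶ (⨁ fun y : Fib α x' => N.obj (pt y.1)) :=
  biproduct.lift fun y =>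
    biproduct.π (fun y : Fib α x => N.obj (pt y.1)) ⟨g.1⁻¹ • y.1, inv_mem_fib α g y⟩ ≫
      N.map (arr g.1 (smul_inv_smul g.1 y.1))

theorem coindMap_π {x x' : ActionCategory G X.V} (g : x ⟶ x') (y : Fib α x) (y' : Fib α x')
    (h : g.1 • y.1 = y'.1) :
    coindMap α N g ≫ biproduct.π (fun y : Fib α x' => N.obj (pt y.1)) y' =
      biproduct.π (fun y : Fib α x => N.obj (pt y.1)) y ≫
        N.map (arr (y := pt y.1) (y' := pt y'.1) g.1 h) := by
  have hy : y = ⟨g.1⁻¹ • y'.1, inv_mem_fib α g y'⟩ :=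
    Subtype.ext ((inv_smul_smul g.1 y.1).symm.trans (congrArg _ h))
  subst hy
  exact biproduct.lift_π _ _

/-- The representation `α_* N`. -/
noncomputable def coind : RepCat A X where
  obj x := ⨁ fun y : Fib α x => N.obj (pt y.1)
  map g := coindMap α N g
  map_id x := by
    refine biproduct.hom_ext _ _ fun y => ?_
    rw [coindMap_π α N (𝟙 x) y y (one_smul G y.1)]
    exact (congrArg _ (N.map_id _)).trans ((Category.comp_id _).trans (Category.id_comp _).symm)
  map_comp {x x' x''} g g' := by
    refine biproduct.hom_ext _ _ fun y => ?_
    let y' : Fib α x' := ⟨g'.1⁻¹ • y.1, inv_mem_fib α g' y⟩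
    let y₀ : Fib α x := ⟨g.1⁻¹ • y'.1, inv_mem_fib α g y'⟩
    have h' : g'.1 • y'.1 = y.1 := smul_inv_smul _ _
    have h : g.1 • y₀.1 = y'.1 := smul_inv_smul _ _
    have h'' : (g ≫ g').1 • y₀.1 = y.1 :=
      (mul_smul g'.1 g.1 y₀.1).trans ((congrArg _ h).trans h')
    rw [Category.assoc, coindMap_π α N g' y' y h', ← Category.assoc, coindMap_π α N g y₀ y' h,
      coindMap_π α N (g ≫ g') y₀ y h'', Category.assoc, ← N.map_comp]
    rfl

end coind

theorem projective_repRes {X Y : GSets.{w} G} (α : Y ⟶ X) (P : RepCat A X) (hP : Projective P) :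
    Projective ((repRes A α).obj P) where
  factors {N M} f e _ := by
    have := Abelian.hasFiniteBiproducts (C := A)
    let e' : coind α N ⟶ coind α M :=
      { app x := biproduct.map fun y : Fib α x => e.app (pt y.1)
        naturality x x' g := by
          refine biproduct.hom_ext _ _ fun y => ?_
          have h : g.1 • (⟨g.1⁻¹ • y.1, inv_mem_fib α g y⟩ : Fib α x).1 = y.1 := smul_inv_smul _ _
          have h₁ := coindMap_π α N g _ y h
          have h₂ := coindMap_π α M g _ y h
          refine (Category.assoc _ _ _).trans ?_
          refine (congrArg (coindMap α N g ≫ ·) (biproduct.map_π _ _)).trans ?_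
          refine (Category.assoc _ _ _).symm.trans ((congrArg (· ≫ e.app (pt y.1)) h₁).trans ?_)
          refine Eq.trans ?_ ((congrArg (biproduct.map (fun y : Fib α x => e.app (pt y.1)) ≫ ·)
            h₂).symm.trans (Category.assoc _ _ _).symm)
          refine Eq.trans ?_ ((congrArg (· ≫ M.map (arr (y := pt (g.1⁻¹ • y.1)) (y' := pt y.1)
            g.1 h)) (biproduct.map_π (fun y : Fib α x => e.app (pt y.1))
            ⟨g.1⁻¹ • y.1, inv_mem_fib α g y⟩)).symm.trans (Category.assoc _ _ _))
          exact (Category.assoc _ _ _).trans ((congrArg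
            (biproduct.π (fun y : Fib α x => N.obj (pt y.1)) ⟨g.1⁻¹ • y.1, inv_mem_fib α g y⟩ ≫ ·)
            (e.naturality (arr (y := pt (g.1⁻¹ • y.1)) (y' := pt y.1) g.1 h))).trans (Category.assoc _ _ _).symm) }
    have : Epi e' := by
      rw [NatTrans.epi_iff_epi_app]
      intro x
      change Epi (biproduct.map fun y : Fib α x => e.app (pt y.1))
      infer_instance
    let f' : P ⟶ coind α M :=
      { app x := biproduct.lift fun y : Fib α x =>
          P.map (arr (y := x) (y' := pt (α.hom y.1)) 1 ((one_smul G _).trans y.2.symm)) ≫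
            f.app (pt y.1)
        naturality x x' g := by
          refine biproduct.hom_ext _ _ fun y => ?_
          have h : g.1 • (⟨g.1⁻¹ • y.1, inv_mem_fib α g y⟩ : Fib α x).1 = y.1 := smul_inv_smul _ _
          have h₂ := coindMap_π α M g _ y h
          refine (Category.assoc _ _ _).trans ?_
          refine (congrArg (P.map g ≫ ·) (biproduct.lift_π _ _)).trans ?_
          refine Eq.trans ?_ ((congrArg (biproduct.lift _ ≫ ·)
            h₂).symm.trans (Category.assoc _ _ _).symm)
          refine Eq.trans ?_ ((congrArg (· ≫ M.map (arr (y := pt (g.1⁻¹ • y.1)) (y' := pt y.1)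
            g.1 h)) (biproduct.lift_π (f := fun y : Fib α x => M.obj (pt y.1)) _
            ⟨g.1⁻¹ • y.1, inv_mem_fib α g y⟩)).symm.trans (Category.assoc _ _ _))
          refine Eq.trans ?_ ((congrArg (P.map _ ≫ ·) (f.naturality (arr (y := pt (g.1⁻¹ • y.1))
            (y' := pt y.1) g.1 h))).trans (Category.assoc _ _ _).symm)
          refine (Category.assoc _ _ _).symm.trans (Eq.trans ?_ (Category.assoc _ _ _))
          refine congrArg (· ≫ f.app (pt y.1)) ((P.map_comp _ _).symm.trans
            (Eq.trans (congrArg P.map (Subtype.ext ?_)) (P.map_comp _ _)))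
          exact (one_mul g.1).trans (mul_one g.1).symm }
    obtain ⟨l, hl⟩ := hP.factors f' e'
    refine ⟨{ app y := l.app ((actionMap α).obj y) ≫
                biproduct.π (fun z : Fib α ((actionMap α).obj y) => N.obj (pt z.1)) ⟨y.back, rfl⟩
              naturality y y' g := ?_ }, ?_⟩
    · have h₁ := coindMap_π α N ((actionMap α).map g) ⟨y.back, rfl⟩ ⟨y'.back, rfl⟩ g.2
      have h₂ := l.naturality ((actionMap α).map g)
      refine (Category.assoc _ _ _).symm.trans ((congrArg (· ≫ _) h₂).trans ?_)
      refine (Category.assoc _ _ _).trans ((congrArg (_ ≫ ·) h₁).trans ?_)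
      exact (Category.assoc _ _ _).symm
    · ext y : 2
      have h := congrArg (fun τ => τ.app ((actionMap α).obj y) ≫
        biproduct.π (fun z : Fib α ((actionMap α).obj y) => M.obj (pt z.1)) ⟨y.back, rfl⟩) hl
      refine Eq.trans ?_ (h.trans ?_)
      · exact ((Category.assoc _ _ _).trans (congrArg (l.app _ ≫ ·) (biproduct.map_π
          (fun z : Fib α ((actionMap α).obj y) => e.app (pt z.1)) ⟨y.back, rfl⟩).symm)).trans
          (Category.assoc _ _ _).symm
      · refine (biproduct.lift_π _ _).trans ?_
        exact (congrArg (· ≫ f.app y) (P.map_id _)).trans (Category.id_comp _)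

/-- The presheaf of categories `X ↦ StRep(X)`, for representations in `k`-vector spaces. -/
def StRep (G : Type t) [Group G] (k : Type u) [Field k] :
    (GSets.{w} G)ᵒᵖ ⥤ Cat.{max w u, max (u + 1) w t} where
  obj X := Cat.of (Stab (RepCat (ModuleCat.{u} k) X.unop))
  map α := (Stab.map (repRes (ModuleCat.{u} k) α.unop) (projective_repRes α.unop)).toCatHom
  map_id _ := congrArg Functor.toCatHom (CategoryTheory.Quotient.lift_unique' _ _ _ rfl)
  map_comp _ _ := congrArg Functor.toCatHom (CategoryTheory.Quotient.lift_unique' _ _ _ rfl)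

end stable

end Sipp

namespace Sipp

open CategoryTheory Limits Opposite

universe w v u t w' t'

/-!
For a `G`-map `α : Y ⟶ X`, summing over the fibres of `α` gives a functor `α_*` that is both right
and left adjoint to `α^*`. If `α` is a sipp cover, the fibres can be weighted by a `G`-invariant
`ℤ_(p)`-valued function with fibre sums `1`, and the weighted sum over the fibres is a natural
retraction of the unit `V ⟶ α_* α^* V`. Hence `α^*` is separable, and a separable left adjoint on an
idempotent-complete category is comonadic by Beck's theorem. By base change (Bénabou–Roubaud),
coalgebras over the comonad `α^* α_*` are the same as descent data, which gives descent for `Rep`.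

The adjunction, the retraction and base change are computed degreewise or on representatives, so they
pass to every localization of `Rep` or of its complexes that inverts a class of morphisms preserved by
`α^*` and `α_*`. Both `D(Rep)` and `StRep` are of this kind, and only their idempotent completeness
remains. Here an Eilenberg swindle applies: if a coproduct `Z` of copies or shifts of `V` satisfies
`Z ≅ V ⊕ Z` compatibly with an idempotent `e` of `V`, then the image of `e` is represented by a cone or
a stable complement. Unbounded complexes are truncated first, so that the coproduct of the shifts
by `2, 4, 6, …` of a complex bounded on one side is degreewise finite.
-/

section Comonadicity

/-- A separability structure on a functor `F`: a natural section of the maps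
`Hom(V, W) ⟶ Hom(F V, F W)`. -/
structure Separability {C D : Type*} [Category* C] [Category* D] (F : C ⥤ D) where
  lift {V W : C} : (F.obj V ⟶ F.obj W) → (V ⟶ W)
  lift_map {V W : C} (f : V ⟶ W) : lift (F.map f) = f
  lift_map_comp {V V' W : C} (f : V' ⟶ V) (k : F.obj V ⟶ F.obj W) :
    lift (F.map f ≫ k) = f ≫ lift k
  lift_comp_map {V W W' : C} (k : F.obj V ⟶ F.obj W) (f : W ⟶ W') :
    lift (k ≫ F.map f) = lift k ≫ f

namespace Separability

variable {C : Type u} {D : Type t} [Category.{v} C] [Category.{v} D] {F : C ⥤ D}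

/-- A natural retraction `ρ` of the unit of an adjunction `F ⊣ R` gives the separability structure
`k ↦ η ≫ R k ≫ ρ`. -/
def ofUnitRetraction {R : D ⥤ C} (adj : F ⊣ R) (ρ : F ⋙ R ⟶ 𝟭 C) (hρ : adj.unit ≫ ρ = 𝟙 (𝟭 C)) :
    Separability F where
  lift {V W} k := adj.homEquiv V (F.obj W) k ≫ ρ.app W
  lift_map {V W} f := by
    have unit_ρ : adj.unit.app W ≫ ρ.app W = 𝟙 W := congrArg (NatTrans.app · W) hρ
    rw [← Category.comp_id (F.map f), adj.homEquiv_naturality_left, adj.homEquiv_id]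
    simp [unit_ρ]
  lift_map_comp f k := by rw [adj.homEquiv_naturality_left, Category.assoc]
  lift_comp_map {V W W'} k f := by
    have ρ_naturality : R.map (F.map f) ≫ ρ.app W' = ρ.app W ≫ f := ρ.naturality f
    rw [adj.homEquiv_naturality_right, Category.assoc, ρ_naturality, Category.assoc]

variable (σ : Separability F)

include σ

theorem reflectsIsomorphisms : F.ReflectsIsomorphisms where
  reflects {V W} g _ := by
    refine ⟨σ.lift (inv (F.map g)), ?_, ?_⟩
    · rw [← σ.lift_map_comp, IsIso.hom_inv_id, ← F.map_id, σ.lift_map]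
    · rw [← σ.lift_comp_map, IsIso.inv_hom_id, ← F.map_id, σ.lift_map]

theorem hasSplitEqualizer [IsIdempotentComplete C] {V W : C} (f g : V ⟶ W)
    [F.IsCosplitPair f g] : HasSplitEqualizer f g := by
  let s := HasSplitEqualizer.isSplitEqualizer (F.map f) (F.map g)
  let t : W ⟶ V := σ.lift s.rightRetraction
  have g_t : g ≫ t = 𝟙 V := by
    rw [← σ.lift_map_comp, s.bottom_rightRetraction, ← F.map_id, σ.lift_map]
  have f_t_comp (h : V ⟶ W) : (f ≫ t) ≫ h = σ.lift (s.leftRetraction ≫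
      HasSplitEqualizer.equalizerι (F.map f) (F.map g) ≫ F.map h) := by
    rw [← σ.lift_map_comp, s.top_rightRetraction, ← σ.lift_comp_map, Category.assoc]
  have f_t_equalizes : (f ≫ t) ≫ f = (f ≫ t) ≫ g := by rw [f_t_comp, f_t_comp, s.condition]
  have f_t_idem : (f ≫ t) ≫ f ≫ t = f ≫ t := by
    rw [← Category.assoc, f_t_equalizes, Category.assoc, g_t, Category.comp_id]
  obtain ⟨E, i, r, i_r, r_i⟩ := IsIdempotentComplete.idempotents_split V (f ≫ t) f_t_idem
  refine ⟨E, i, ⟨r, t, ?_, i_r, g_t, r_i.symm⟩⟩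
  calc i ≫ f = i ≫ (f ≫ t) ≫ f := by rw [← r_i, Category.assoc, reassoc_of% i_r]
    _ = i ≫ (f ≫ t) ≫ g := by rw [f_t_equalizes]
    _ = i ≫ g := by rw [← r_i, Category.assoc, reassoc_of% i_r]

theorem isEquivalence_comonadComparison [IsIdempotentComplete C] {R : D ⥤ C} (adj : F ⊣ R) :
    (Comonad.comparison adj).IsEquivalence := by
  have := σ.reflectsIsomorphisms
  have : Comonad.HasEqualizerOfIsCosplitPair F :=
    ⟨fun f g _ => have := σ.hasSplitEqualizer f g; inferInstance⟩
  have : Comonad.PreservesLimitOfIsCosplitPair F :=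
    ⟨fun f g _ => by
      have := σ.hasSplitEqualizer f g
      let s := HasSplitEqualizer.isSplitEqualizer f g
      exact preservesLimit_of_preserves_limit_cone s.isEqualizer
        ((isLimitMapConeForkEquiv F s.condition).symm (s.map F).isEqualizer)⟩
  exact (Comonad.comonadicOfHasPreservesFSplitEqualizersOfReflectsIsomorphisms adj).eqv

end Separability

end Comonadicity

section Pushforward

/-- A morphism `ε : F P ⟶ N` is couniversal if every `F T ⟶ N` factors uniquely through it, so that
`P` is the value at `N` of a partial right adjoint of `F`. -/
def IsCouniversal {C D : Type*} [Category* C] [Category* D] (F : C ⥤ D) {P : C} {N : D}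
    (ε : F.obj P ⟶ N) : Prop :=
  ∀ T : C, Function.Bijective fun m : T ⟶ P => F.map m ≫ ε

section

variable {C D : Type*} [Category* C] [Category* D] {F : C ⥤ D}

theorem isCouniversal_counit {R : D ⥤ C} (adj : F ⊣ R) (N : D) :
    IsCouniversal F (adj.counit.app N) := fun T => by
  simpa only [← adj.homEquiv_counit] using! (adj.homEquiv T N).symm.bijective

theorem IsCouniversal.map_iso_comp {P P' : C} {N : D} {ε : F.obj P ⟶ N} (hε : IsCouniversal F ε)
    (e : P' ≅ P) : IsCouniversal F (F.map e.hom ≫ ε) := fun T => by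
  simpa only [Function.comp_def, Iso.homToEquiv_apply, F.map_comp, Category.assoc] using
    (hε T).comp (e.homToEquiv (Z := T)).bijective

theorem IsCouniversal.comp_iso {P : C} {N N' : D} {ε : F.obj P ⟶ N} (hε : IsCouniversal F ε)
    (e : N ≅ N') : IsCouniversal F (ε ≫ e.hom) := fun T => by
  simpa only [Function.comp_def, Iso.homToEquiv_apply, Category.assoc] using
    (e.homToEquiv (Z := F.obj T)).bijective.comp (hε T)

theorem IsCouniversal.exists_iso {P P' : C} {N : D} {ε : F.obj P ⟶ N} {ε' : F.obj P' ⟶ N}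
    (hε : IsCouniversal F ε) (hε' : IsCouniversal F ε') :
    ∃ e : P' ≅ P, F.map e.hom ≫ ε = ε' := by
  obtain ⟨a, ha⟩ := (hε P').surjective ε'
  obtain ⟨b, hb⟩ := (hε' P).surjective ε
  dsimp only at ha hb
  exact ⟨⟨a, b, (hε' P').injective (by simp [hb, ha]), (hε P).injective (by simp [hb, ha])⟩, ha⟩

end

variable {C : Type u} [Category.{v} C] (D : Cᵒᵖ ⥤ Cat.{w, t})

/-- The identification `g^* f^* V = g'^* f'^* V` for a commutative square `g ≫ f = g' ≫ f'`. -/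
abbrev resSwap {X Y Y' Z : C} {f : Y ⟶ X} {f' : Y' ⟶ X} {g : Z ⟶ Y} {g' : Z ⟶ Y'}
    (sq : g ≫ f = g' ≫ f') (V : D.obj (op X)) :
    (res D g).obj ((res D f).obj V) ⟶ (res D g').obj ((res D f').obj V) :=
  eqToHom ((res_obj_eq D sq V).trans (res_obj_eq D rfl V).symm)

theorem resSwap_naturality {X Y Y' Z : C} {f : Y ⟶ X} {f' : Y' ⟶ X} {g : Z ⟶ Y} {g' : Z ⟶ Y'}
    (sq : g ≫ f = g' ≫ f') {V V' : D.obj (op X)} (φ : V ⟶ V') :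
    (res D g).map ((res D f).map φ) ≫ resSwap D sq V' =
      resSwap D sq V ≫ (res D g').map ((res D f').map φ) := by
  rw [res_map_eq D sq φ, res_map_eq D (g := g') (f := f') rfl φ]
  simp

variable {D}

/-- The base change `f'^* h^* P ⟶ h'^* N` of a morphism `ε : f^* P ⟶ N` along a commutative
square. -/
def baseChange {S X Y Z : C} {f' : Z ⟶ S} {h' : Z ⟶ Y} {h : S ⟶ X} {f : Y ⟶ X}
    (sq : f' ≫ h = h' ≫ f) {P : D.obj (op X)} {N : D.obj (op Y)} (ε : (res D f).obj P ⟶ N) :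
    (res D f').obj ((res D h).obj P) ⟶ (res D h').obj N :=
  resSwap D sq P ≫ (res D h').map ε

section

variable {S X Y Z : C} {f' : Z ⟶ S} {h' : Z ⟶ Y} {h : S ⟶ X} {f : Y ⟶ X}
  (sq : f' ≫ h = h' ≫ f)

theorem map_map_comp_baseChange {P P' : D.obj (op X)} {N : D.obj (op Y)} (c : P ⟶ P')
    (ε : (res D f).obj P' ⟶ N) :
    (res D f').map ((res D h).map c) ≫ baseChange sq ε =
      baseChange sq ((res D f).map c ≫ ε) := by
  rw [baseChange, reassoc_of% resSwap_naturality D sq c, baseChange, Functor.map_comp]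

theorem baseChange_comp {P : D.obj (op X)} {N N' : D.obj (op Y)} (ε : (res D f).obj P ⟶ N)
    (d : N ⟶ N') : baseChange sq (ε ≫ d) = baseChange sq ε ≫ (res D h').map d := by
  simp only [baseChange, Functor.map_comp, Category.assoc]

theorem baseChange_paste {T : C} {Q : C} {k : T ⟶ S} {k' : Q ⟶ Z} {f'' : Q ⟶ T} {g : T ⟶ X}
    {g' : Q ⟶ Y} (hk : k ≫ h = g) (hk' : k' ≫ h' = g') (sq' : f'' ≫ k = k' ≫ f')
    (sq'' : f'' ≫ g = g' ≫ f) {P : D.obj (op X)} {N : D.obj (op Y)} (ε : (res D f).obj P ⟶ N)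
    {V : D.obj (op S)} (m : V ⟶ (res D h).obj P) :
    (res D f'').map ((res D k).map m ≫ eqToHom (res_obj_eq D hk P)) ≫ baseChange sq'' ε =
      resSwap D sq' V ≫ (res D k').map ((res D f').map m ≫ baseChange sq ε) ≫
        eqToHom (res_obj_eq D hk' N) := by
  subst hk hk'
  rw [Functor.map_comp, Functor.map_comp, Category.assoc, Category.assoc,
    ← reassoc_of% resSwap_naturality D sq' m]
  simp only [baseChange, Functor.map_comp, Category.assoc, res_map_eq D rfl ε, eqToHom_map,
    eqToHom_trans, eqToHom_trans_assoc, eqToHom_refl, Category.comp_id]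

end

/-- A morphism `ε : f^* P ⟶ N` is a universal push-forward if all its base changes along cartesian
squares are couniversal. -/
def IsUniversalPushforward {X Y : C} {f : Y ⟶ X} {P : D.obj (op X)} {N : D.obj (op Y)}
    (ε : (res D f).obj P ⟶ N) : Prop :=
  ∀ ⦃S Z : C⦄ {f' : Z ⟶ S} {h' : Z ⟶ Y} {h : S ⟶ X} (sq : IsPullback f' h' h f),
    IsCouniversal (res D f') (baseChange sq.w ε)

/-- A strictly natural family of functors between two presheaves of categories (whose values may
live in different universes). -/
structure StrictMap {C : Type u} [Category.{v} C] (D : Cᵒᵖ ⥤ Cat.{w, t})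
    (E : Cᵒᵖ ⥤ Cat.{w', t'}) where
  app (X : C) : D.obj (op X) ⥤ E.obj (op X)
  naturality {X Y : C} (f : Y ⟶ X) : app X ⋙ res E f = res D f ⋙ app Y

namespace StrictMap

variable {E : Cᵒᵖ ⥤ Cat.{w', t'}} (L : StrictMap D E) {X Y : C} {f : Y ⟶ X}

theorem res_obj_app (V : D.obj (op X)) :
    (res E f).obj ((L.app X).obj V) = (L.app Y).obj ((res D f).obj V) :=
  Functor.congr_obj (L.naturality f) V

theorem res_map_app {V W : D.obj (op X)} (φ : V ⟶ W) :
    (res E f).map ((L.app X).map φ) = eqToHom (L.res_obj_app V) ≫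
      (L.app Y).map ((res D f).map φ) ≫ eqToHom (L.res_obj_app W).symm :=
  Functor.congr_hom (L.naturality f) φ

/-- The image `f^* L P ⟶ L N` of a morphism `f^* P ⟶ N`. -/
def mapCounit {P : D.obj (op X)} {N : D.obj (op Y)} (ε : (res D f).obj P ⟶ N) :
    (res E f).obj ((L.app X).obj P) ⟶ (L.app Y).obj N :=
  eqToHom (L.res_obj_app P) ≫ (L.app Y).map ε

theorem map_map_comp_mapCounit {P P' : D.obj (op X)} {N : D.obj (op Y)} (c : P' ⟶ P)
    (ε : (res D f).obj P ⟶ N) :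
    (res E f).map ((L.app X).map c) ≫ L.mapCounit ε = L.mapCounit ((res D f).map c ≫ ε) := by
  simp [mapCounit, res_map_app]

theorem baseChange_mapCounit {S Z : C} {f' : Z ⟶ S} {h' : Z ⟶ Y} {h : S ⟶ X}
    (sq : f' ≫ h = h' ≫ f) {P : D.obj (op X)} {N : D.obj (op Y)} (ε : (res D f).obj P ⟶ N) :
    baseChange sq (L.mapCounit ε) = (res E f').map (eqToHom (L.res_obj_app P)) ≫
      L.mapCounit (baseChange sq ε) ≫ eqToHom (L.res_obj_app N).symm := by
  simp [baseChange, mapCounit, res_map_app, eqToHom_map]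

end StrictMap

theorem IsUniversalPushforward.mapCounit {E : Cᵒᵖ ⥤ Cat.{w', t'}} (L : StrictMap D E)
    (hL : ∀ ⦃X Y : C⦄ (f : Y ⟶ X) (N : D.obj (op Y)), ∃ (P : D.obj (op X))
      (ε : (res D f).obj P ⟶ N), IsCouniversal (res D f) ε ∧
        IsCouniversal (res E f) (L.mapCounit ε))
    {X Y : C} {f : Y ⟶ X} {P : D.obj (op X)} {N : D.obj (op Y)} {ε : (res D f).obj P ⟶ N}
    (hε : IsUniversalPushforward ε) : IsUniversalPushforward (L.mapCounit ε) := by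
  intro S Z f' h' h sq
  obtain ⟨P', ε', hε', hLε'⟩ := hL f' ((res D h').obj N)
  obtain ⟨e, he⟩ := hε'.exists_iso (hε sq)
  rw [L.baseChange_mapCounit, ← he, ← L.map_map_comp_mapCounit]
  exact ((hLε'.map_iso_comp ((L.app S).mapIso e)).comp_iso
    (eqToIso (L.res_obj_app N).symm)).map_iso_comp (eqToIso (L.res_obj_app P))

end Pushforward

section Descent

variable {C : Type u} [Category.{v} C] {D : Cᵒᵖ ⥤ Cat.{w, t}}

theorem res_map_injective_of_section {X Y : C} {f : Y ⟶ X} {s : X ⟶ Y} (hs : s ≫ f = 𝟙 X)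
    {V V' : D.obj (op X)} : Function.Injective ((res D f).map : (V ⟶ V') → _) := by
  have res_comp : res D f ⋙ res D s = 𝟭 _ := by
    rw [← Cat.Hom.comp_toFunctor, ← D.map_comp, ← op_comp, hs]
    simp
  have := Functor.Faithful.of_comp_eq res_comp
  exact (res D f).map_injective

/-- The inverse image of an isomorphism, as `pullHom` for its two directions. -/
@[simps]
def pullIso {X₁ X₂ Y Z : C} {f₁ : Y ⟶ X₁} {f₂ : Y ⟶ X₂} {V₁ : D.obj (op X₁)} {V₂ : D.obj (op X₂)}
    (φ : (res D f₁).obj V₁ ≅ (res D f₂).obj V₂) (g : Z ⟶ Y) {h₁ : Z ⟶ X₁} {h₂ : Z ⟶ X₂}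
    (w₁ : g ≫ f₁ = h₁) (w₂ : g ≫ f₂ = h₂) : (res D h₁).obj V₁ ≅ (res D h₂).obj V₂ where
  hom := pullHom D φ.hom g w₁ w₂
  inv := pullHom D φ.inv g w₂ w₁
  hom_inv_id := by simp [pullHom, ← Functor.map_comp_assoc]
  inv_hom_id := by simp [pullHom, ← Functor.map_comp_assoc]

variable [HasPullbacks C] {X U : C} {α : U ⟶ X}

theorem DescentDatum.cocycle_inv (W : DescentDatum D α) :
    (res D (pr₁₂ α)).map W.glue.inv ≫ resSwap D pullback.condition W.obj ≫
        (res D (pr₂₃ α)).map W.glue.inv =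
      resSwap D (pullback.lift_fst _ _ _).symm W.obj ≫ (res D (pr₁₃ α)).map W.glue.inv ≫
        resSwap D (pullback.lift_snd _ _ _) W.obj := by
  have cocycle : pullIso W.glue (pr₁₃ α) (pullback.lift_snd _ _ _) (pullback.lift_fst _ _ _) =
      pullIso W.glue (pr₂₃ α) rfl pullback.condition.symm ≪≫ pullIso W.glue (pr₁₂ α) rfl rfl :=
    Iso.ext W.cocycle
  have := congrArg (fun e => eqToHom (res_obj_eq D rfl W.obj) ≫ e.inv ≫
        eqToHom (res_obj_eq D rfl W.obj).symm) cocycle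
  simpa [pullHom, resSwap] using this.symm

namespace DescentDatum

variable {R : D.obj (op U) ⥤ D.obj (op X)} {adj : res D α ⊣ R}
  (hR : ∀ N, IsUniversalPushforward (adj.counit.app N))

/-- By base change along `α`, morphisms `V ⟶ α^* α_* N` are the same as morphisms
`pr₁^* V ⟶ pr₂^* N`. -/
noncomputable def transpose (V N : D.obj (op U)) :
    (V ⟶ (res D α).obj (R.obj N)) ≃ ((res D (pr₁ α)).obj V ⟶ (res D (pr₂ α)).obj N) :=
  Equiv.ofBijective _ (hR N (IsPullback.of_hasPullback α α) V)

theorem transpose_apply {V N : D.obj (op U)} (m : V ⟶ (res D α).obj (R.obj N)) :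
    transpose hR V N m =
      (res D (pr₁ α)).map m ≫ baseChange pullback.condition (adj.counit.app N) :=
  rfl

theorem transpose_comp {V V' N : D.obj (op U)} (f : V ⟶ V')
    (m : V' ⟶ (res D α).obj (R.obj N)) :
    transpose hR V N (f ≫ m) = (res D (pr₁ α)).map f ≫ transpose hR V' N m := by
  rw [transpose_apply, transpose_apply, Functor.map_comp, Category.assoc]

theorem transpose_comp_map {V N N' : D.obj (op U)} (m : V ⟶ (res D α).obj (R.obj N))
    (f : N ⟶ N') :
    transpose hR V N' (m ≫ (res D α).map (R.map f)) =
      transpose hR V N m ≫ (res D (pr₂ α)).map f := by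
  have counit_naturality : (res D α).map (R.map f) ≫ adj.counit.app N' = adj.counit.app N ≫ f :=
    adj.counit_naturality f
  rw [transpose_apply, transpose_apply, Functor.map_comp, Category.assoc, map_map_comp_baseChange,
    counit_naturality, baseChange_comp, Category.assoc]

theorem transpose_comp_map_unit {V : D.obj (op U)} {P : D.obj (op X)} (m : V ⟶ (res D α).obj P) :
    transpose hR V ((res D α).obj P) (m ≫ (res D α).map (adj.unit.app P)) =
      (res D (pr₁ α)).map m ≫ resSwap D pullback.condition P := by
  have triangle : (res D α).map (adj.unit.app P) ≫ adj.counit.app ((res D α).obj P) =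
      𝟙 ((res D α).obj P) :=
    adj.left_triangle_components P
  have baseChange_id : baseChange (D := D) pullback.condition (𝟙 ((res D α).obj P)) =
      resSwap D (pullback.condition (f := α) (g := α)) P := by
    rw [baseChange, CategoryTheory.Functor.map_id, Category.comp_id]
  rw [transpose_apply, Functor.map_comp, Category.assoc, map_map_comp_baseChange, triangle]
  exact congrArg _ baseChange_id

/-- The coaction `W ⟶ α^* α_* W` of a descent datum: the transpose of the inverse of the gluing
isomorphism. -/
noncomputable def coaction (W : DescentDatum D α) : W.obj ⟶ (res D α).obj (R.obj W.obj) :=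
  (transpose hR W.obj W.obj).symm W.glue.inv

theorem transpose_coaction (W : DescentDatum D α) :
    transpose hR W.obj W.obj (W.coaction hR) = W.glue.inv :=
  Equiv.apply_symm_apply _ _

theorem map_coaction_comp_resSwap (W : DescentDatum D α) :
    (res D (pr₁ α)).map (W.coaction hR) ≫ resSwap D pullback.condition (R.obj W.obj) =
      W.glue.inv ≫ (res D (pr₂ α)).map (W.coaction hR) := by
  have pr₁₃_pr₁ : pr₁₃ α ≫ pr₁ α = pr₁₂ α ≫ pr₁ α := pullback.lift_fst _ _ _
  have pr₁₃_pr₂ : pr₁₃ α ≫ pr₂ α = pr₂₃ α ≫ pr₂ α := pullback.lift_snd _ _ _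
  have sq : IsPullback (pr₁₂ α) (pr₂₃ α ≫ pr₂ α) (pr₂ α ≫ α) α :=
    (IsPullback.of_hasPullback (pr₂ α) (pr₁ α)).paste_vert (IsPullback.of_hasPullback α α)
  rw [← cancel_mono (eqToHom (res_obj_eq D rfl (R.obj W.obj))), Category.assoc, Category.assoc,
    eqToHom_trans]
  apply (hR W.obj sq _).injective
  dsimp only
  rw [Functor.map_comp _ W.glue.inv, Category.assoc,
    baseChange_paste pullback.condition pullback.condition pr₁₃_pr₂ pr₁₃_pr₁.symm,
    baseChange_paste pullback.condition rfl rfl pullback.condition, ← transpose_apply hR,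
    transpose_coaction]
  have := congrArg (· ≫ eqToHom (res_obj_eq D rfl W.obj)) W.cocycle_inv
  simpa only [Category.assoc, eqToHom_trans] using this.symm

theorem coaction_coassoc (W : DescentDatum D α) :
    W.coaction hR ≫ (res D α).map (adj.unit.app (R.obj W.obj)) =
      W.coaction hR ≫ (res D α).map (R.map (W.coaction hR)) := by
  apply (transpose hR _ _).injective
  rw [transpose_comp_map_unit, transpose_comp_map, transpose_coaction, map_coaction_comp_resSwap]

theorem coaction_counit (W : DescentDatum D α) :
    W.coaction hR ≫ adj.counit.app W.obj = 𝟙 W.obj := by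
  have coaction_map_counit :
      W.coaction hR ≫ (res D α).map (R.map (W.coaction hR ≫ adj.counit.app W.obj)) =
        W.coaction hR := by
    have triangle := adj.right_triangle_components W.obj
    rw [R.map_comp, Functor.map_comp, ← reassoc_of% W.coaction_coassoc hR, ← Functor.map_comp,
      triangle, CategoryTheory.Functor.map_id, Category.comp_id]
  have map_counit : (res D (pr₂ α)).map (W.coaction hR ≫ adj.counit.app W.obj) = 𝟙 _ := by
    rw [← cancel_epi W.glue.inv, Category.comp_id, ← transpose_coaction hR, ← transpose_comp_map,
      coaction_map_counit]
    rfl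
  have diagonal_pr₂ : pullback.lift (𝟙 U) (𝟙 U) rfl ≫ pr₂ α = 𝟙 U := pullback.lift_snd _ _ _
  refine res_map_injective_of_section diagonal_pr₂ ?_
  rw [map_counit, CategoryTheory.Functor.map_id]

theorem coaction_comp_map_iff {W W' : DescentDatum D α} (f : W.obj ⟶ W'.obj) :
    W.coaction hR ≫ (res D α).map (R.map f) = f ≫ W'.coaction hR ↔
      W.glue.hom ≫ (res D (pr₁ α)).map f = (res D (pr₂ α)).map f ≫ W'.glue.hom := by
  rw [← (transpose hR _ _).apply_eq_iff_eq, transpose_comp_map, transpose_comp,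
    transpose_coaction, transpose_coaction, Iso.inv_comp_eq, ← Category.assoc, Iso.eq_comp_inv,
    eq_comm]

theorem coaction_comparison (V : D.obj (op X)) :
    ((comparison D α).obj V).coaction hR = (res D α).map (adj.unit.app V) := by
  refine (Equiv.symm_apply_eq _).2 ?_
  have := transpose_comp_map_unit hR (𝟙 ((res D α).obj V))
  rw [Category.id_comp, CategoryTheory.Functor.map_id, Category.id_comp] at this
  exact this.symm

/-- The functor of Bénabou and Roubaud from descent data to coalgebras over the comonad
`α^* α_*`. -/
noncomputable def toCoalgebra : DescentDatum D α ⥤ adj.toComonad.Coalgebra where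
  obj W := ⟨W.obj, W.coaction hR, W.coaction_counit hR, W.coaction_coassoc hR⟩
  map f := ⟨f.hom, (coaction_comp_map_iff hR f.hom).2 f.comm⟩

instance : (toCoalgebra hR).Faithful where
  map_injective h := DescentDatum.Hom.ext (congrArg Comonad.Coalgebra.Hom.f h)

instance : (toCoalgebra hR).Full where
  map_surjective g := ⟨⟨g.f, (coaction_comp_map_iff hR g.f).1 g.h⟩, rfl⟩

/-- Under `toCoalgebra`, the comparison functor of descent becomes that of the comonad
`α^* α_*`. -/
noncomputable def comparisonCompToCoalgebraIso :
    comparison D α ⋙ toCoalgebra hR ≅ Comonad.comparison adj :=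
  NatIso.ofComponents
    (fun V => Comonad.Coalgebra.isoMk (Iso.refl ((res D α).obj V)) <| by
      have map_id : (res D α).map (R.map (𝟙 ((res D α).obj V))) =
          𝟙 ((res D α).obj (R.obj ((res D α).obj V))) := by
        rw [R.map_id, CategoryTheory.Functor.map_id]
      exact ((congrArg _ map_id).trans (Category.comp_id _)).trans
        ((coaction_comparison hR V).trans (Category.id_comp _).symm))
    fun f => Comonad.Coalgebra.Hom.ext' _ _ _ _
      ((Category.comp_id _).trans (Category.id_comp _).symm)

end DescentDatum

theorem isEquivalence_comparison {R : D.obj (op U) ⥤ D.obj (op X)} (adj : res D α ⊣ R)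
    (hR : ∀ N, IsUniversalPushforward (adj.counit.app N)) (σ : Separability (res D α))
    [IsIdempotentComplete (D.obj (op X))] : (comparison D α).IsEquivalence := by
  have := σ.isEquivalence_comonadComparison adj
  have := Functor.isEquivalence_of_iso (DescentDatum.comparisonCompToCoalgebraIso hR).symm
  have := Functor.Faithful.of_comp (comparison D α) (DescentDatum.toCoalgebra hR)
  have := Functor.Full.of_comp_faithful (comparison D α) (DescentDatum.toCoalgebra hR)
  have := Functor.essSurj_of_comp_fully_faithful (comparison D α) (DescentDatum.toCoalgebra hR)
  exact {}

end Descent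

section Representations

variable {G : Type t} [Group G] {A : Type u} [Category.{v} A] {X Y : GSets.{w} G} {α : Y ⟶ X}

/-- The arrow `x ⟶ α y` given by the unit of `G`, for `y` in the fibre of `α` over `x`. -/
abbrev fibArr {x : ActionCategory G X.V} (y : Fib α x) : x ⟶ (actionMap α).obj (pt y.1) :=
  arr 1 ((one_smul G _).trans y.2.symm)

/-- The inverse `α y ⟶ x` of `fibArr y`. -/
abbrev fibArrInv {x : ActionCategory G X.V} (y : Fib α x) : (actionMap α).obj (pt y.1) ⟶ x :=
  arr 1 ((one_smul G _).trans y.2)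

theorem fibArr_comp_fibArrInv {x : ActionCategory G X.V} (y : Fib α x) :
    fibArr y ≫ fibArrInv y = 𝟙 x :=
  Subtype.ext (one_mul 1)

theorem comp_fibArr {x x' : ActionCategory G X.V} (g : x ⟶ x') (y : Fib α x) (y' : Fib α x')
    (h : g.1 • y.1 = y'.1) :
    g ≫ fibArr y' = fibArr y ≫ (actionMap α).map (arr (y := pt y.1) (y' := pt y'.1) g.1 h) :=
  Subtype.ext ((one_mul g.1).trans (mul_one g.1).symm)

theorem fibArrInv_comp {x x' : ActionCategory G X.V} (g : x ⟶ x') (y : Fib α x) (y' : Fib α x')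
    (h : g.1 • y.1 = y'.1) : fibArrInv y ≫ g =
      (actionMap α).map (arr (y := pt y.1) (y' := pt y'.1) g.1 h) ≫ fibArrInv y' :=
  Subtype.ext ((mul_one g.1).trans (one_mul g.1).symm)

/-- The component `P_x ⟶ N_y` of a morphism `ε : α^* P ⟶ N` at a point `y` of the fibre of `α`
over `x`. -/
def fibProj {P : RepCat A X} {N : RepCat A Y} (ε : (repRes A α).obj P ⟶ N)
    {x : ActionCategory G X.V} (y : Fib α x) : P.obj x ⟶ N.obj (pt y.1) :=
  P.map (fibArr y) ≫ ε.app (pt y.1)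

section

variable {P T : RepCat A X} {N : RepCat A Y} (ε : (repRes A α).obj P ⟶ N)

theorem fibProj_self (y : ActionCategory G Y.V) :
    fibProj ε (x := (actionMap α).obj y) ⟨y.back, rfl⟩ = ε.app y :=
  (congrArg (· ≫ ε.app y) (P.map_id _)).trans (Category.id_comp _)

theorem app_comp_fibProj (m : T ⟶ P) {x : ActionCategory G X.V} (y : Fib α x) :
    m.app x ≫ fibProj ε y = fibProj ((repRes A α).map m ≫ ε) y := by
  rw [fibProj, ← NatTrans.naturality_assoc]
  rfl

theorem map_comp_fibProj {x x' : ActionCategory G X.V} (g : x ⟶ x') (y : Fib α x)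
    (y' : Fib α x') (h : g.1 • y.1 = y'.1) :
    P.map g ≫ fibProj ε y' =
      fibProj ε y ≫ N.map (arr (y := pt y.1) (y' := pt y'.1) g.1 h) := by
  have ε_naturality := ε.naturality (arr (y := pt y.1) (y' := pt y'.1) g.1 h)
  rw [fibProj, ← P.map_comp_assoc, comp_fibArr g y y' h, P.map_comp_assoc, fibProj, Category.assoc,
    ← ε_naturality]
  rfl

end

/-- A morphism `ε : α^* P ⟶ N` is a fibrewise product if its components exhibit each `P_x` as the
product of the `N_y` over the fibre of `α` over `x`. -/
def IsFibrewiseProduct {P : RepCat A X} {N : RepCat A Y} (ε : (repRes A α).obj P ⟶ N) : Prop :=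
  ∀ (x : ActionCategory G X.V) (T : A),
    Function.Bijective fun (m : T ⟶ P.obj x) (y : Fib α x) => m ≫ fibProj ε y

theorem IsFibrewiseProduct.isCouniversal {P : RepCat A X} {N : RepCat A Y}
    {ε : (repRes A α).obj P ⟶ N} (hε : IsFibrewiseProduct ε) : IsCouniversal (repRes A α) ε := by
  refine fun T => ⟨fun m m' h => ?_, fun n => ?_⟩
  · ext x
    refine (hε x _).injective (funext fun y => ?_)
    dsimp only at h ⊢
    rw [app_comp_fibProj, app_comp_fibProj, h]
  · choose m hm using fun x => (hε x (T.obj x)).surjective fun y => fibProj n y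
    replace hm (x : ActionCategory G X.V) (y : Fib α x) : m x ≫ fibProj ε y = fibProj n y :=
      congrFun (hm x) y
    refine ⟨{ app := m, naturality x x' g := (hε x' _).injective (funext fun y' => ?_) }, ?_⟩
    · let y : Fib α x := ⟨g.1⁻¹ • y'.1, inv_mem_fib α g y'⟩
      have hy : g.1 • y.1 = y'.1 := smul_inv_smul _ _
      dsimp only
      rw [Category.assoc, hm, Category.assoc, map_comp_fibProj n g y y' hy,
        map_comp_fibProj ε g y y' hy, reassoc_of% hm]
    · ext y
      rw [← fibProj_self, ← app_comp_fibProj, hm, fibProj_self]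

section BaseChange

variable {S Z : GSets.{w} G} {f' : Z ⟶ S} {h' : Z ⟶ Y} {h : S ⟶ X}

theorem hom_hom_eq_of_comm (sq : f' ≫ h = h' ≫ α) (z : Z.V) :
    α.hom (h'.hom z) = h.hom (f'.hom z) :=
  (ConcreteCategory.congr_hom (congrArg Action.Hom.hom sq) z).symm

/-- The map from the fibre of `f'` over `s` to the fibre of `α` over `h s` induced by a commutative
square. -/
def fibMap (sq : f' ≫ h = h' ≫ α) {s : ActionCategory G S.V} (z : Fib f' s) :
    Fib α ((actionMap h).obj s) :=
  ⟨h'.hom z.1, (hom_hom_eq_of_comm sq z.1).trans (congrArg h.hom z.2)⟩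

theorem bijective_fibMap (sq : IsPullback f' h' h α) (s : ActionCategory G S.V) :
    Function.Bijective (fibMap sq.w (s := s)) := by
  have sq_types := sq.map (Action.forget FintypeCat G ⋙ FintypeCat.incl)
  refine ⟨fun z z' hz => ?_, fun y => ?_⟩
  · exact Subtype.ext (Types.ext_of_isPullback sq_types (z.2.trans z'.2.symm)
      (congrArg Subtype.val hz))
  · obtain ⟨z, hz, hzy⟩ := Types.exists_of_isPullback sq_types s.back y.1 y.2.symm
    exact ⟨⟨z, hz⟩, Subtype.ext hzy⟩

theorem val_eqToHom_actionCategory {x x' : ActionCategory G X.V} (e : x = x') :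
    (eqToHom e).1 = 1 := by
  subst e
  rfl

theorem resSwap_app (sq : f' ≫ h = h' ≫ α) (P : RepCat A X) (z : ActionCategory G Z.V) :
    NatTrans.app (C := ActionCategory G Z.V) (resSwap (Rep.{w} G A) sq P) z =
      P.map (arr (y := (actionMap h).obj ((actionMap f').obj z))
        (y' := (actionMap α).obj ((actionMap h').obj z)) 1
        ((one_smul G _).trans (hom_hom_eq_of_comm sq z.back).symm)) := by
  have obj_eq : (actionMap h).obj ((actionMap f').obj z) =
      (actionMap α).obj ((actionMap h').obj z) :=
    congrArg (fun x => (pt x : ActionCategory G X.V)) (hom_hom_eq_of_comm sq z.back).symm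
  refine (eqToHom_app _ z).trans ((eqToHom_map P obj_eq).symm.trans (congrArg P.map ?_))
  exact Subtype.ext (val_eqToHom_actionCategory obj_eq)

theorem fibProj_baseChange (sq : f' ≫ h = h' ≫ α) {P : RepCat A X} {N : RepCat A Y}
    (ε : (repRes A α).obj P ⟶ N) {s : ActionCategory G S.V} (z : Fib f' s) :
    fibProj (P := (repRes A h).obj P) (N := (repRes A h').obj N)
      (baseChange (D := Rep.{w} G A) sq ε) z = fibProj ε (fibMap sq z) := by
  have map_fibArr_comp : (actionMap h).map (fibArr z) ≫ arr
      (y := (actionMap h).obj ((actionMap f').obj (pt z.1)))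
      (y' := (actionMap α).obj ((actionMap h').obj (pt z.1))) 1
      ((one_smul G _).trans (hom_hom_eq_of_comm sq z.1).symm) = fibArr (fibMap sq z) :=
    Subtype.ext (one_mul 1)
  change P.map ((actionMap h).map (fibArr z)) ≫
    NatTrans.app (C := ActionCategory G Z.V) (resSwap (Rep.{w} G A) sq P) (pt z.1) ≫
      ε.app ((actionMap h').obj (pt z.1)) = _
  rw [resSwap_app]
  exact (P.map_comp_assoc _ _ _).symm.trans
    (congrArg (P.map · ≫ ε.app ((actionMap h').obj (pt z.1))) map_fibArr_comp)

theorem IsFibrewiseProduct.baseChange (sq : IsPullback f' h' h α) {P : RepCat A X}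
    {N : RepCat A Y} {ε : (repRes A α).obj P ⟶ N} (hε : IsFibrewiseProduct ε) :
    IsFibrewiseProduct (P := (repRes A h).obj P) (N := (repRes A h').obj N)
      (baseChange (D := Rep.{w} G A) sq.w ε) := fun s T => by
  simp only [fibProj_baseChange]
  let reindex := Equiv.piCongrLeft (fun y : Fib α ((actionMap h).obj s) => T ⟶ N.obj (pt y.1))
    (Equiv.ofBijective _ (bijective_fibMap sq s))
  exact reindex.symm.bijective.comp (hε ((actionMap h).obj s) T)

theorem IsFibrewiseProduct.isUniversalPushforward {P : RepCat A X}
    {N : RepCat A Y} {ε : (repRes A α).obj P ⟶ N} (hε : IsFibrewiseProduct ε) :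
    IsUniversalPushforward (D := Rep.{w} G A) ε :=
  fun _ _ _ _ _ sq => (hε.baseChange sq).isCouniversal

end BaseChange

section Pushforward

variable [HasZeroMorphisms A] [HasFiniteBiproducts A] (α)

/-- The values of `N` over the fibre of `α` over `x`. -/
abbrev fibFamily (N : RepCat A Y) (x : ActionCategory G X.V) (y : Fib α x) : A :=
  N.obj (pt y.1)

/-- The action of an arrow `g` of the action groupoid of `X` on `⨁_{α y = x} N_y`. -/
noncomputable def pushMap (N : RepCat A Y) {x x' : ActionCategory G X.V} (g : x ⟶ x') :
    ⨁ fibFamily α N x ⟶ ⨁ fibFamily α N x' :=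
  biproduct.lift fun y =>
    biproduct.π (fibFamily α N x) ⟨g.1⁻¹ • y.1, inv_mem_fib α g y⟩ ≫
      N.map (arr g.1 (smul_inv_smul g.1 y.1))

variable {α} in
theorem pushMap_π (N : RepCat A Y) {x x' : ActionCategory G X.V} (g : x ⟶ x') (y : Fib α x)
    (y' : Fib α x') (h : g.1 • y.1 = y'.1) :
    pushMap α N g ≫ biproduct.π (fibFamily α N x') y' = biproduct.π (fibFamily α N x) y ≫
      N.map (arr (y := pt y.1) (y' := pt y'.1) g.1 h) := by
  obtain rfl : y = ⟨g.1⁻¹ • y'.1, inv_mem_fib α g y'⟩ :=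
    Subtype.ext ((inv_smul_smul g.1 y.1).symm.trans (congrArg _ h))
  exact biproduct.lift_π _ _

variable {α} in
theorem ι_pushMap (N : RepCat A Y) {x x' : ActionCategory G X.V} (g : x ⟶ x') (y : Fib α x)
    (y' : Fib α x') (h : g.1 • y.1 = y'.1) :
    biproduct.ι (fibFamily α N x) y ≫ pushMap α N g =
      N.map (arr (y := pt y.1) (y' := pt y'.1) g.1 h) ≫ biproduct.ι (fibFamily α N x') y' := by
  classical
  refine biproduct.hom_ext _ _ fun z' => ?_
  let z : Fib α x := ⟨g.1⁻¹ • z'.1, inv_mem_fib α g z'⟩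
  have hz : g.1 • z.1 = z'.1 := smul_inv_smul _ _
  rw [Category.assoc, Category.assoc, pushMap_π N g z z' hz]
  by_cases hyz : y = z
  · obtain rfl : y' = z' := Subtype.ext (h.symm.trans ((congrArg (g.1 • ·.1) hyz).trans hz))
    subst hyz
    simp
  · have hyz' : y' ≠ z' := fun e => hyz (Subtype.ext (MulAction.injective g.1
      (h.trans ((congrArg Subtype.val e).trans hz.symm))))
    rw [biproduct.ι_π_ne_assoc _ hyz, biproduct.ι_π_ne _ hyz', zero_comp, comp_zero]

/-- The push-forward functor `α_*`, with `(α_* N)_x = ⨁_{α y = x} N_y`. -/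
noncomputable def push : RepCat A Y ⥤ RepCat A X where
  obj N :=
    { obj x := ⨁ fibFamily α N x
      map g := pushMap α N g
      map_id x := by
        refine biproduct.hom_ext _ _ fun y => ?_
        rw [pushMap_π N (𝟙 x) y y (one_smul G y.1), Category.id_comp]
        exact (congrArg _ (N.map_id _)).trans (Category.comp_id _)
      map_comp {x x' x''} g g' := by
        refine biproduct.hom_ext _ _ fun y => ?_
        let y' : Fib α x' := ⟨g'.1⁻¹ • y.1, inv_mem_fib α g' y⟩
        let y₀ : Fib α x := ⟨g.1⁻¹ • y'.1, inv_mem_fib α g y'⟩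
        have hy' : g'.1 • y'.1 = y.1 := smul_inv_smul _ _
        have hy₀ : g.1 • y₀.1 = y'.1 := smul_inv_smul _ _
        have hy : (g ≫ g').1 • y₀.1 = y.1 :=
          (mul_smul g'.1 g.1 y₀.1).trans ((congrArg _ hy₀).trans hy')
        rw [Category.assoc, pushMap_π N g' y' y hy', ← Category.assoc, pushMap_π N g y₀ y' hy₀,
          pushMap_π N (g ≫ g') y₀ y hy, Category.assoc, ← N.map_comp]
        rfl }
  map {N N'} n :=
    { app x := biproduct.map fun y : Fib α x => n.app (pt y.1)
      naturality x x' g := by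
        refine biproduct.hom_ext _ _ fun y' => ?_
        let y : Fib α x := ⟨g.1⁻¹ • y'.1, inv_mem_fib α g y'⟩
        have hy : g.1 • y.1 = y'.1 := smul_inv_smul _ _
        have n_naturality := n.naturality (arr (y := pt y.1) (y' := pt y'.1) g.1 hy)
        rw [Category.assoc, biproduct.map_π, reassoc_of% pushMap_π N g y y' hy, n_naturality,
          Category.assoc, pushMap_π N' g y y' hy, biproduct.map_π_assoc] }
  map_id N := by
    ext x : 2
    exact biproduct.hom_ext _ _ fun y => by simp
  map_comp n n' := by
    ext x : 2
    exact biproduct.hom_ext _ _ fun y => by simp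

/-- The unit `P ⟶ α_* α^* P` at `P`: the diagonal of `P_x` at each point `x`. -/
noncomputable def toPush (P : RepCat A X) : P ⟶ (push α).obj ((repRes A α).obj P) where
  app x := biproduct.lift (f := fibFamily α ((repRes A α).obj P) x) fun y => P.map (fibArr y)
  naturality x x' g := by
    change P.map g ≫ biproduct.lift _ = biproduct.lift _ ≫ pushMap α ((repRes A α).obj P) g
    refine biproduct.hom_ext _ _ fun y' => ?_
    let y : Fib α x := ⟨g.1⁻¹ • y'.1, inv_mem_fib α g y'⟩
    have hy : g.1 • y.1 = y'.1 := smul_inv_smul _ _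
    rw [Category.assoc, Category.assoc, pushMap_π _ g y y' hy, biproduct.lift_π,
      biproduct.lift_π_assoc, ← P.map_comp, comp_fibArr g y y' hy]
    exact P.map_comp _ _

/-- The transfer `α_* α^* P ⟶ P` at `P`: the codiagonal of `P_x` at each point `x`. -/
noncomputable def fromPush (P : RepCat A X) : (push α).obj ((repRes A α).obj P) ⟶ P where
  app x := biproduct.desc (f := fibFamily α ((repRes A α).obj P) x) fun y => P.map (fibArrInv y)
  naturality x x' g := by
    change pushMap α ((repRes A α).obj P) g ≫ biproduct.desc _ = biproduct.desc _ ≫ P.map g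
    refine biproduct.hom_ext' _ _ fun y => ?_
    let y' : Fib α x' := ⟨g.1 • y.1, (hom_smul α g.1 y.1).trans
      ((congrArg (g.1 • ·) y.2).trans g.2)⟩
    have hy : g.1 • y.1 = y'.1 := rfl
    rw [reassoc_of% ι_pushMap _ g y y' hy, biproduct.ι_desc_assoc, biproduct.ι_desc,
      ← P.map_comp, fibArrInv_comp g y y' hy]
    exact (P.map_comp _ _).symm

end Pushforward

end Representations

section Adjunctions

variable {G : Type t} [Group G] {A : Type u} [Category.{v} A] [HasZeroMorphisms A]
  [HasFiniteBiproducts A] {X Y : GSets.{w} G} (α : Y ⟶ X)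

/-- The counit `α^* α_* N ⟶ N` at `N`: the projection of `⨁_{α z = α y} N_z` to `N_y` at each
point `y`. -/
noncomputable def pushProj (N : RepCat A Y) : (repRes A α).obj ((push α).obj N) ⟶ N where
  app y := biproduct.π (fibFamily α N ((actionMap α).obj y)) ⟨y.back, rfl⟩
  naturality y y' g :=
    pushMap_π N ((actionMap α).map g) ⟨y.back, rfl⟩ ⟨y'.back, rfl⟩ g.2

/-- The unit `N ⟶ α^* α_* N` at `N`: the inclusion of `N_y` into `⨁_{α z = α y} N_z` at each
point `y`. -/
noncomputable def pushIncl (N : RepCat A Y) : N ⟶ (repRes A α).obj ((push α).obj N) where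
  app y := biproduct.ι (fibFamily α N ((actionMap α).obj y)) ⟨y.back, rfl⟩
  naturality y y' g :=
    (ι_pushMap N ((actionMap α).map g) ⟨y.back, rfl⟩ ⟨y'.back, rfl⟩ g.2).symm

variable {α} in
theorem fibProj_pushProj (N : RepCat A Y) {x : ActionCategory G X.V} (y : Fib α x) :
    fibProj (pushProj α N) y = biproduct.π (fibFamily α N x) y :=
  (pushMap_π N (fibArr y) y ⟨y.1, rfl⟩ (one_smul G y.1)).trans
    ((congrArg _ (N.map_id _)).trans (Category.comp_id _))

theorem isFibrewiseProduct_pushProj (N : RepCat A Y) : IsFibrewiseProduct (pushProj α N) :=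
  fun x T => by
    simp only [fibProj_pushProj]
    exact ⟨fun m m' h => biproduct.hom_ext _ _ (congrFun h),
      fun k => ⟨biproduct.lift k, funext fun y => biproduct.lift_π _ _⟩⟩

variable {α} in
theorem comp_toPush {P P' : RepCat A X} (f : P ⟶ P') :
    f ≫ toPush α P' = toPush α P ≫ (push α).map ((repRes A α).map f) := by
  ext x : 2
  change f.app x ≫ biproduct.lift _ = biproduct.lift _ ≫
    biproduct.map (f := fibFamily α ((repRes A α).obj P) x)
      (g := fibFamily α ((repRes A α).obj P') x) fun y => f.app ((actionMap α).obj (pt y.1))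
  refine biproduct.hom_ext _ _ fun y => ?_
  rw [Category.assoc, Category.assoc, biproduct.lift_π, biproduct.map_π, biproduct.lift_π_assoc]
  exact (f.naturality (fibArr y)).symm

variable {α} in
theorem map_comp_fromPush {P P' : RepCat A X} (f : P ⟶ P') :
    (push α).map ((repRes A α).map f) ≫ fromPush α P' = fromPush α P ≫ f := by
  ext x : 2
  change biproduct.map (f := fibFamily α ((repRes A α).obj P) x)
      (g := fibFamily α ((repRes A α).obj P') x) (fun y => f.app ((actionMap α).obj (pt y.1))) ≫
    biproduct.desc _ = biproduct.desc _ ≫ f.app x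
  refine biproduct.hom_ext' _ _ fun y => ?_
  rw [biproduct.ι_map_assoc, biproduct.ι_desc, biproduct.ι_desc_assoc]
  exact (f.naturality (fibArrInv y)).symm

theorem map_toPush_comp_pushProj (P : RepCat A X) :
    (repRes A α).map (toPush α P) ≫ pushProj α ((repRes A α).obj P) = 𝟙 _ := by
  ext y : 2
  exact (biproduct.lift_π (f := fibFamily α ((repRes A α).obj P) ((actionMap α).obj y)) _ _).trans
    (P.map_id _)

theorem toPush_comp_map_pushProj (N : RepCat A Y) :
    toPush α ((push α).obj N) ≫ (push α).map (pushProj α N) = 𝟙 _ := by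
  ext x : 2
  change biproduct.lift _ ≫ biproduct.map
    (f := fibFamily α ((repRes A α).obj ((push α).obj N)) x) (g := fibFamily α N x)
    (fun y => (pushProj α N).app (pt y.1)) = 𝟙 (⨁ fibFamily α N x)
  refine biproduct.hom_ext _ _ fun y => ?_
  rw [Category.assoc, biproduct.map_π, Category.id_comp]
  exact (biproduct.lift_π_assoc (f := fibFamily α ((repRes A α).obj ((push α).obj N)) x)
    _ _ _).trans (fibProj_pushProj N y)

theorem map_pushIncl_comp_fromPush (N : RepCat A Y) :
    (push α).map (pushIncl α N) ≫ fromPush α ((push α).obj N) = 𝟙 _ := by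
  ext x : 2
  change biproduct.map (f := fibFamily α N x)
    (g := fibFamily α ((repRes A α).obj ((push α).obj N)) x)
    (fun y => (pushIncl α N).app (pt y.1)) ≫ biproduct.desc _ = 𝟙 (⨁ fibFamily α N x)
  refine biproduct.hom_ext' _ _ fun y => ?_
  rw [biproduct.ι_map_assoc, Category.comp_id]
  refine (congrArg (_ ≫ ·) (biproduct.ι_desc
    (f := fibFamily α ((repRes A α).obj ((push α).obj N)) x) _ _)).trans ?_
  exact (ι_pushMap N (fibArrInv y) ⟨y.1, rfl⟩ y (one_smul G y.1)).trans
    ((congrArg (· ≫ _) (N.map_id _)).trans (Category.id_comp _))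

theorem pushIncl_comp_map_fromPush (P : RepCat A X) :
    pushIncl α ((repRes A α).obj P) ≫ (repRes A α).map (fromPush α P) = 𝟙 _ := by
  ext y : 2
  exact (biproduct.ι_desc (f := fibFamily α ((repRes A α).obj P) ((actionMap α).obj y)) _ _).trans
    (P.map_id _)

/-- The functor `α_*` is right adjoint to `α^*`. -/
noncomputable def repResPushAdjunction : repRes A α ⊣ push α :=
  Adjunction.mkOfUnitCounit
    { unit := { app := toPush α, naturality _ _ f := comp_toPush f }
      counit := {
        app := pushProj α
        naturality N N' n := by
          ext y : 2
          exact biproduct.map_π (fun z : Fib α ((actionMap α).obj y) => n.app (pt z.1)) _ }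
      left_triangle := by
        ext P : 2
        exact (congrArg _ (Category.id_comp _)).trans (map_toPush_comp_pushProj α P)
      right_triangle := by
        ext N : 2
        exact (congrArg _ (Category.id_comp _)).trans (toPush_comp_map_pushProj α N) }

/-- The functor `α_*` is left adjoint to `α^*`. -/
noncomputable def pushRepResAdjunction : push α ⊣ repRes A α :=
  Adjunction.mkOfUnitCounit
    { unit := {
        app := pushIncl α
        naturality N N' n := by
          ext y : 2
          exact (biproduct.ι_map (fun z : Fib α ((actionMap α).obj y) => n.app (pt z.1))
            ⟨y.back, rfl⟩).symm }
      counit := { app := fromPush α, naturality _ _ f := map_comp_fromPush f }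
      left_triangle := by
        ext N : 2
        exact (congrArg _ (Category.id_comp _)).trans (map_pushIncl_comp_fromPush α N)
      right_triangle := by
        ext P : 2
        exact (congrArg _ (Category.id_comp _)).trans (pushIncl_comp_map_fromPush α P) }

end Adjunctions

section Weights

variable {G : Type t} [Group G]

noncomputable instance {X Y : GSets.{w} G} (α : Y ⟶ X) (x : ActionCategory G X.V) :
    Fintype (Fib α x) :=
  Fintype.ofFinite _

/-- A system of weights on the fibres of `α`: a `G`-invariant function on its source whose values
sum up to `1` along each fibre of `α`. -/
structure FibreWeight {X Y : GSets.{w} G} (α : Y ⟶ X) (R : Type*) [Semiring R] where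
  weight : Y.V → R
  smul (g : G) (y : Y.V) : weight (g • y) = weight y
  sum_eq_one (x : ActionCategory G X.V) : ∑ y : Fib α x, weight y.1 = 1

section Transfer

theorem biproduct_lift_comp_desc {A : Type*} [Category* A] [Preadditive A] {J : Type*} [Fintype J]
    {f : J → A} [HasBiproduct f] {P Q : A} (g : ∀ j, P ⟶ f j) (h : ∀ j, f j ⟶ Q) :
    biproduct.lift g ≫ biproduct.desc h = ∑ j, g j ≫ h j := by
  have total : ∑ j, biproduct.π f j ≫ biproduct.ι f j = 𝟙 (⨁ f) :=
    IsBilimit.total (biproduct.isBilimit f)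
  rw [← Category.id_comp (biproduct.desc h), ← total, Preadditive.sum_comp, Preadditive.comp_sum]
  exact Finset.sum_congr rfl fun j _ => by
    rw [Category.assoc, biproduct.ι_desc, biproduct.lift_π_assoc]

variable {A : Type u} [Category.{v} A] [Preadditive A] [HasFiniteBiproducts A]
  {X Y : GSets.{w} G} {α : Y ⟶ X} {R : Type*} [Semiring R] [Linear R A] (c : FibreWeight α R)

namespace FibreWeight

/-- Multiplication by the weights, as a natural endomorphism of the identity functor. -/
def smulEnd : 𝟭 (RepCat A Y) ⟶ 𝟭 (RepCat A Y) where
  app N :=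
    { app y := c.weight y.back • 𝟙 (N.obj y)
      naturality y y' g := by
        have weight_eq : c.weight y'.back = c.weight y.back :=
          (congrArg c.weight g.2.symm).trans (c.smul g.1 y.back)
        simp [weight_eq] }
  naturality N N' n := by
    ext y
    simp

/-- The transfer `α_* α^* P ⟶ P`, weighted by `c`. -/
noncomputable def transfer : repRes A α ⋙ push α ⟶ 𝟭 (RepCat A X) :=
  Functor.whiskerLeft (repRes A α) (Functor.whiskerRight c.smulEnd (push α)) ≫
    (pushRepResAdjunction α).counit

theorem unit_comp_transfer :
    (repResPushAdjunction α).unit ≫ c.transfer (A := A) = 𝟙 (𝟭 (RepCat A X)) := by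
  ext P x : 4
  change biproduct.lift _ ≫ biproduct.map (f := fibFamily α ((repRes A α).obj P) x)
    (g := fibFamily α ((repRes A α).obj P) x) (fun y => c.weight y.1 • 𝟙 _) ≫
      biproduct.desc _ = 𝟙 (P.obj x)
  rw [biproduct.map_desc]
  have term (y : Fib α x) : P.map (fibArr y) ≫ (c.weight y.1 • 𝟙 _) ≫ P.map (fibArrInv y) =
      c.weight y.1 • 𝟙 (P.obj x) := by
    rw [Linear.smul_comp, Category.id_comp, Linear.comp_smul, ← P.map_comp,
      fibArr_comp_fibArrInv, P.map_id]
  calc _ = ∑ y : Fib α x, P.map (fibArr y) ≫ (c.weight y.1 • 𝟙 _) ≫ P.map (fibArrInv y) :=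
        biproduct_lift_comp_desc _ _
    _ = ∑ y : Fib α x, c.weight y.1 • 𝟙 (P.obj x) := Finset.sum_congr rfl fun y _ => term y
    _ = 𝟙 (P.obj x) := by rw [← Finset.sum_smul, c.sum_eq_one, one_smul]

end FibreWeight

end Transfer

section

variable {X Y : GSets.{w} G} (α : Y ⟶ X)

theorem ncard_inter_fibre_smul {S : Set Y.V} (hS : ∀ (g : G) (y : Y.V), g • y ∈ S ↔ y ∈ S) (g : G)
    (x : X.V) : {y ∈ S | α.hom y = g • x}.ncard = {y ∈ S | α.hom y = x}.ncard := by
  rw [← Set.ncard_image_of_injective {y ∈ S | α.hom y = x} (MulAction.injective g)]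
  congr 1
  ext y
  constructor
  · rintro ⟨hy, hyx⟩
    exact ⟨g⁻¹ • y, ⟨(hS _ _).2 hy, by rw [hom_smul, hyx, inv_smul_smul]⟩, smul_inv_smul g y⟩
  · rintro ⟨z, ⟨hz, rfl⟩, rfl⟩
    exact ⟨(hS _ _).2 hz, hom_smul α g z⟩

theorem ncard_orbit_inter_fibre (u : Y.V) :
    {y ∈ MulAction.orbit G u | α.hom y = α.hom u}.ncard =
      (MulAction.stabilizer G u).relIndex (MulAction.stabilizer G (α.hom u)) := by
  have orbit_stabilizer : {y ∈ MulAction.orbit G u | α.hom y = α.hom u} =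
      MulAction.orbit (MulAction.stabilizer G (α.hom u)) u := by
    ext y
    constructor
    · rintro ⟨⟨g, rfl⟩, hg⟩
      exact ⟨⟨g, (hom_smul α g u).symm.trans hg⟩, rfl⟩
    · rintro ⟨⟨g, hg⟩, rfl⟩
      exact ⟨⟨g, rfl⟩, (hom_smul α g u).trans hg⟩
  rw [orbit_stabilizer, ← MulAction.index_stabilizer]
  rfl

variable {α} {p : ℕ}

/-- The set `S` is a union of orbits, one over each orbit of the target. -/
theorem IsSippCovering.exists_invariant_coprime_fibres
    (hα : IsSippCovering p (Presieve.singleton α)) :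
    ∃ S : Set Y.V, (∀ (g : G) (y : Y.V), g • y ∈ S ↔ y ∈ S) ∧
      ∀ x : X.V, {y ∈ S | α.hom y = x}.ncard.Coprime p := by
  have exists_lift (x : X.V) : ∃ u : Y.V, α.hom u = x ∧
      ((MulAction.stabilizer G u).relIndex (MulAction.stabilizer G x)).Coprime p := by
    obtain ⟨_, _, ⟨⟩, h⟩ := hα x
    exact h
  choose u hu u_coprime using exists_lift
  let rep (x : X.V) : X.V := (Quotient.mk (MulAction.orbitRel G X.V) x).out
  have rep_smul (g : G) (x : X.V) : rep (g • x) = rep x :=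
    congrArg Quotient.out (Quotient.sound (s := MulAction.orbitRel G X.V) ⟨g, rfl⟩)
  have smul_mem (g : G) (y : Y.V) : g • y ∈ MulAction.orbit G (u (rep (α.hom (g • y)))) ↔
      y ∈ MulAction.orbit G (u (rep (α.hom y))) := by
    rw [hom_smul, rep_smul, ← MulAction.orbit_eq_iff, MulAction.orbit_smul, MulAction.orbit_eq_iff]
  refine ⟨{y | y ∈ MulAction.orbit G (u (rep (α.hom y)))}, smul_mem, fun x => ?_⟩
  obtain ⟨g, hg⟩ : ∃ g : G, g • x = rep x :=
    Quotient.exact (s := MulAction.orbitRel G X.V) (Quotient.out_eq _)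
  have rep_rep : rep (rep x) = rep x := by rw [← hg, rep_smul, hg]
  have fibre_eq : {y | y ∈ MulAction.orbit G (u (rep (α.hom y))) ∧ α.hom y = rep x} =
      {y ∈ MulAction.orbit G (u (rep x)) | α.hom y = rep x} := by
    ext y
    exact and_congr_left fun hy => by rw [hy, rep_rep]
  have card_fibre := ncard_orbit_inter_fibre α (u (rep x))
  rw [hu] at card_fibre
  rw [← ncard_inter_fibre_smul α smul_mem g x, hg]
  exact (congrArg Set.ncard fibre_eq).trans card_fibre ▸ u_coprime (rep x)

open Classical in
theorem IsSippCovering.nonempty_fibreWeight (hα : IsSippCovering p (Presieve.singleton α))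
    {R : Type*} [CommRing R] (hR : ∀ n : ℕ, n.Coprime p → IsUnit (n : R)) :
    Nonempty (FibreWeight α R) := by
  obtain ⟨S, smul_mem, card_coprime⟩ := hα.exists_invariant_coprime_fibres
  let card (x : X.V) : ℕ := {y ∈ S | α.hom y = x}.ncard
  refine ⟨⟨fun y => if y ∈ S then Ring.inverse (card (α.hom y) : R) else 0, fun g y => ?_,
    fun x => ?_⟩⟩
  · have card_smul : card (α.hom (g • y)) = card (α.hom y) := by
      rw [hom_smul]
      exact ncard_inter_fibre_smul α smul_mem g _
    simp only [smul_mem, card_smul]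
  · have card_fibre : (Finset.univ.filter fun y : Fib α x => y.1 ∈ S).card = card x.back := by
      have image_eq : {y ∈ S | α.hom y = x.back} = Subtype.val '' {y : Fib α x | y.1 ∈ S} := by
        ext y
        exact ⟨fun hy => ⟨⟨y, hy.2⟩, hy.1, rfl⟩, by rintro ⟨z, hz, rfl⟩; exact ⟨hz, z.2⟩⟩
      rw [← Set.ncard_coe_finset, Finset.coe_filter_univ]
      exact ((congrArg Set.ncard image_eq).trans
        (Set.ncard_image_of_injective _ Subtype.val_injective)).symm
    calc ∑ y : Fib α x, (if y.1 ∈ S then Ring.inverse (card (α.hom y.1) : R) else 0)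
        = ∑ y : Fib α x, if y.1 ∈ S then Ring.inverse (card x.back : R) else 0 :=
          Finset.sum_congr rfl fun y _ => by rw [y.2]
      _ = card x.back * Ring.inverse (card x.back : R) := by
          rw [Finset.sum_ite, Finset.sum_const_zero, add_zero, Finset.sum_const, nsmul_eq_mul,
            card_fibre]
      _ = 1 := Ring.mul_inverse_cancel _ (hR _ (card_coprime _))

theorem isUnit_natCast_zLoc [Fact p.Prime] {n : ℕ} (hn : n.Coprime p) : IsUnit (n : ZLoc p) := by
  have n_mem : (n : ℤ) ∈ (Ideal.span {(p : ℤ)}).primeCompl := fun h =>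
    (Nat.Prime.coprime_iff_not_dvd Fact.out).1 hn.symm
      (Int.natCast_dvd_natCast.1 (Ideal.mem_span_singleton.1 h))
  simpa using IsLocalization.map_units (ZLoc p) ⟨(n : ℤ), n_mem⟩

theorem isUnit_natCast_of_charP [Fact p.Prime] {k : Type*} [Field k] [CharP k p] {n : ℕ}
    (hn : n.Coprime p) : IsUnit (n : k) := by
  rw [isUnit_iff_ne_zero, Ne, CharP.cast_eq_zero_iff k p]
  exact (Nat.Prime.coprime_iff_not_dvd Fact.out).1 hn.symm

end

end Weights

section

variable {G : Type t} [Group G] {A : Type u} [Category.{v} A] [Preadditive A] [HasFiniteProducts A]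

theorem isAdditivePresheaf_rep : IsAdditivePresheaf (Rep.{w} G A) :=
  ⟨fun X => inferInstanceAs (Preadditive (RepCat A X)),
    fun X => inferInstanceAs (HasFiniteProducts (RepCat A X)),
    fun _ _ f => inferInstanceAs (repRes A f).Additive⟩

theorem isStrictStack_rep [Finite G] (p : ℕ) [Fact p.Prime] [Linear (ZLoc p) A]
    [IsIdempotentComplete A] : IsStrictStack (Rep.{w} G A) (sippTopology G p) :=
  fun X U α hα => by
    have := HasFiniteBiproducts.of_hasFiniteProducts (C := A)
    obtain ⟨c⟩ := IsSippCovering.nonempty_fibreWeight hα fun _ => isUnit_natCast_zLoc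
    have : IsIdempotentComplete ((Rep.{w} G A).obj (op X)) :=
      inferInstanceAs (IsIdempotentComplete (RepCat A X))
    exact isEquivalence_comparison (D := Rep.{w} G A) (repResPushAdjunction α)
      (fun N => (isFibrewiseProduct_pushProj α N).isUniversalPushforward)
      (Separability.ofUnitRetraction (repResPushAdjunction α) c.transfer c.unit_comp_transfer)

end

section Localization

theorem exists_unitRetraction_localization {C C' D D' : Type*} [Category* C] [Category* C']
    [Category* D] [Category* D'] {F : C ⥤ D} {R : D ⥤ C} (adj : F ⊣ R) {ρ : F ⋙ R ⟶ 𝟭 C}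
    (hρ : adj.unit ≫ ρ = 𝟙 (𝟭 C)) (L₁ : C ⥤ C') (W₁ : MorphismProperty C) [L₁.IsLocalization W₁]
    (L₂ : D ⥤ D') (W₂ : MorphismProperty D) [L₂.IsLocalization W₂] (F' : C' ⥤ D') (R' : D' ⥤ C')
    [CatCommSq F L₁ L₂ F'] [CatCommSq R L₂ L₁ R'] :
    ∃ ρ' : F' ⋙ R' ⟶ 𝟭 C', (adj.localization L₁ W₁ L₂ W₂ F' R').unit ≫ ρ' = 𝟙 (𝟭 C') := by
  let : Localization.Lifting L₁ W₁ ((F ⋙ R) ⋙ L₁) (F' ⋙ R') :=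
    ⟨(CatCommSq.hComp F R L₁ L₂ L₁ F' R').iso.symm⟩
  refine ⟨Localization.liftNatTrans L₁ W₁ ((F ⋙ R) ⋙ L₁) L₁ (F' ⋙ R') (𝟭 C')
    (Functor.whiskerRight ρ L₁), Localization.natTrans_ext L₁ W₁ fun V => ?_⟩
  have unit_ρ : adj.unit.app V ≫ ρ.app V = 𝟙 V := NatTrans.congr_app hρ V
  have map_unit_ρ : L₁.map (adj.unit.app V) ≫ L₁.map (ρ.app V) = 𝟙 (L₁.obj V) := by
    rw [← L₁.map_comp, unit_ρ]
    exact L₁.map_id V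
  have lifting_iso : (Localization.Lifting.iso L₁ W₁ ((F ⋙ R) ⋙ L₁) (F' ⋙ R')).hom.app V =
      R'.map ((CatCommSq.iso F L₁ L₂ F').inv.app V) ≫
        (CatCommSq.iso R L₂ L₁ R').inv.app (F.obj V) := by
    simp [this, Localization.Lifting.iso]
  simp [lifting_iso, ← R'.map_comp_assoc, map_unit_ρ]

variable {C : Type u} [Category.{v} C] {D : Cᵒᵖ ⥤ Cat.{w, t}} {E : Cᵒᵖ ⥤ Cat.{w', t'}}

section

variable {X Y : C} {f : Y ⟶ X}

theorem IsUniversalPushforward.map_iso_comp {P P' : D.obj (op X)} {N : D.obj (op Y)}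
    {ε : (res D f).obj P ⟶ N} (hε : IsUniversalPushforward ε) (e : P' ≅ P) :
    IsUniversalPushforward ((res D f).map e.hom ≫ ε) := fun S _ _ _ h sq => by
  rw [← map_map_comp_baseChange]
  exact (hε sq).map_iso_comp ((res D h).mapIso e)

theorem IsUniversalPushforward.comp_iso {P : D.obj (op X)} {N N' : D.obj (op Y)}
    {ε : (res D f).obj P ⟶ N} (hε : IsUniversalPushforward ε) (e : N ≅ N') :
    IsUniversalPushforward (ε ≫ e.hom) := fun _ _ _ h' _ sq => by
  rw [baseChange_comp]
  exact (hε sq).comp_iso ((res D h').mapIso e)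

end

namespace StrictMap

variable (L : StrictMap D E) (W : ∀ X : C, MorphismProperty (D.obj (op X)))
  [∀ X, (L.app X).IsLocalization (W X)]
  {push : ∀ ⦃X Y : C⦄, (Y ⟶ X) → (D.obj (op Y) ⥤ D.obj (op X))}
  (adj : ∀ ⦃X Y : C⦄ (f : Y ⟶ X), res D f ⊣ push f)
  (hW : ∀ ⦃X Y : C⦄ (f : Y ⟶ X), (W Y).IsInvertedBy (push f ⋙ L.app X))
  {X Y : C} (f : Y ⟶ X)

instance : CatCommSq (res D f) (L.app X) (L.app Y) (res E f) :=
  ⟨eqToIso (L.naturality f).symm⟩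

/-- The functor on localized categories induced by `push f`. -/
noncomputable def localizedPush : E.obj (op Y) ⥤ E.obj (op X) :=
  Localization.lift (push f ⋙ L.app X) (hW f) (L.app Y)

noncomputable instance :
    CatCommSq (push f) (L.app Y) (L.app X) (L.localizedPush W hW f) :=
  ⟨(Localization.fac (push f ⋙ L.app X) (hW f) (L.app Y)).symm⟩

/-- The adjunction between `res E f` and `localizedPush` induced by the one between `res D f` and
`push f`. -/
noncomputable def localizedAdjunction : res E f ⊣ L.localizedPush W hW f :=
  (adj f).localization (L.app X) (W X) (L.app Y) (W Y) (res E f) (L.localizedPush W hW f)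

theorem localizedAdjunction_counit_app (N : D.obj (op Y)) :
    (L.localizedAdjunction W adj hW f).counit.app ((L.app Y).obj N) =
      (res E f).map ((CatCommSq.iso (push f) (L.app Y) (L.app X)
        (L.localizedPush W hW f)).symm.app N).hom ≫ L.mapCounit ((adj f).counit.app N) := by
  have iso_inv_app : (CatCommSq.iso (res D f) (L.app X) (L.app Y) (res E f)).inv.app
      ((push f).obj N) = eqToHom (L.res_obj_app _) :=
    eqToHom_app (L.naturality f) _
  have := (adj f).localization_counit_app (L.app X) (W X) (L.app Y) (W Y) (res E f)
    (L.localizedPush W hW f) N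
  simpa only [iso_inv_app] using! this

include hW in
theorem isCouniversal_mapCounit (N : D.obj (op Y)) :
    IsCouniversal (res E f) (L.mapCounit ((adj f).counit.app N)) := by
  have := (isCouniversal_counit (L.localizedAdjunction W adj hW f) ((L.app Y).obj N)).map_iso_comp
    ((CatCommSq.iso (push f) (L.app Y) (L.app X) (L.localizedPush W hW f)).app N)
  rw [localizedAdjunction_counit_app, ← Functor.map_comp_assoc] at this
  simpa using! this

variable {f} in
theorem isUniversalPushforward_localizedAdjunction
    (hadj : ∀ N, IsUniversalPushforward ((adj f).counit.app N)) (M : E.obj (op Y)) :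
    IsUniversalPushforward ((L.localizedAdjunction W adj hW f).counit.app M) := by
  have := Localization.essSurj (L.app Y) (W Y)
  have hN (N : D.obj (op Y)) :
      IsUniversalPushforward ((L.localizedAdjunction W adj hW f).counit.app ((L.app Y).obj N)) := by
    rw [localizedAdjunction_counit_app]
    exact ((hadj N).mapCounit L fun X Y f N => ⟨_, _, isCouniversal_counit (adj f) N,
      L.isCouniversal_mapCounit W adj hW f N⟩).map_iso_comp _
  let e := (L.app Y).objObjPreimageIso M
  have := ((hN _).comp_iso e).map_iso_comp ((L.localizedPush W hW f).mapIso e.symm)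
  have counit_naturality := (L.localizedAdjunction W adj hW f).counit.naturality e.inv
  simp only [Functor.comp_map, Functor.id_map] at counit_naturality
  rw [Functor.mapIso_hom, Iso.symm_hom, reassoc_of% counit_naturality] at this
  simpa using this

include hW in
theorem isEquivalence_comparison_of_isLocalization [HasPullbacks C]
    (hadj : ∀ N, IsUniversalPushforward ((adj f).counit.app N))
    {ρ : res D f ⋙ push f ⟶ 𝟭 (D.obj (op X))} (hρ : (adj f).unit ≫ ρ = 𝟙 _)
    [IsIdempotentComplete (E.obj (op X))] : (comparison E f).IsEquivalence := by
  obtain ⟨ρ', hρ'⟩ := exists_unitRetraction_localization (adj f) hρ (L.app X) (W X) (L.app Y)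
    (W Y) (res E f) (L.localizedPush W hW f)
  exact isEquivalence_comparison (L.localizedAdjunction W adj hW f)
    (L.isUniversalPushforward_localizedAdjunction W adj hW hadj)
    (Separability.ofUnitRetraction _ ρ' hρ')

end StrictMap

end Localization

section Swindle

open Idempotents

attribute [local instance] hasBinaryBiproducts_of_finite_biproducts
  preservesBinaryBiproducts_of_preservesBiproducts

theorem isIdempotentComplete_of_essImage_toKaroubi {D : Type*} [Category* D]
    (h : ∀ P : Karoubi D, (toKaroubi D).essImage P) : IsIdempotentComplete D := by
  have : (toKaroubi D).EssSurj := ⟨h⟩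
  have : (toKaroubi D).IsEquivalence := { }
  exact (isIdempotentComplete_iff_of_equivalence (toKaroubi D).asEquivalence).2 inferInstance

/-- A coproduct of a sequence splits off its first term. -/
noncomputable def sigmaIsoBiprod {D : Type*} [Category* D] [HasZeroMorphisms D]
    [HasBinaryBiproducts D] (Z : ℕ → D) [HasCoproduct Z] [HasCoproduct fun n => Z (n + 1)] :
    ∐ Z ≅ Z 0 ⊞ ∐ fun n => Z (n + 1) where
  hom := Sigma.desc fun
    | 0 => biprod.inl
    | n + 1 => Sigma.ι (fun n => Z (n + 1)) n ≫ biprod.inr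
  inv := biprod.desc (Sigma.ι Z 0) (Sigma.desc fun n => Sigma.ι Z (n + 1))
  hom_inv_id := Sigma.hom_ext _ _ fun n => by cases n <;> simp
  inv_hom_id := by
    refine biprod.hom_ext' _ _ (by simp) ?_
    rw [biprod.inr_desc_assoc, Category.comp_id]
    exact Sigma.hom_ext _ _ fun n => by simp

variable {D : Type*} [Category* D] [Preadditive D] [HasFiniteBiproducts D]

variable (D) in
/-- An additive category is weakly idempotent complete if every split monomorphism is the inclusion
of a direct summand. -/
def IsWeaklyIdempotentComplete : Prop :=
  ∀ ⦃A B : D⦄ (s : A ⟶ B) [IsSplitMono s], ∃ (N : D) (e : B ≅ A ⊞ N), s ≫ e.hom = biprod.inl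

theorem IsWeaklyIdempotentComplete.essImage_toKaroubi (hD : IsWeaklyIdempotentComplete D)
    {A B : D} {P : Karoubi D} (e : (toKaroubi D).obj A ⊞ P ≅ (toKaroubi D).obj B) :
    (toKaroubi D).essImage P := by
  let s : A ⟶ B := (toKaroubi D).preimage (biprod.inl ≫ e.hom)
  have : IsSplitMono s := ⟨⟨{ retraction := (toKaroubi D).preimage (e.inv ≫ biprod.fst)
                              id := (toKaroubi D).map_injective (by simp [s]) }⟩⟩
  obtain ⟨N, f, hf⟩ := hD s
  let k : (toKaroubi D).obj A ⊞ P ≅ (toKaroubi D).obj A ⊞ (toKaroubi D).obj N :=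
    e ≪≫ (toKaroubi D).mapIso f ≪≫ (toKaroubi D).mapBiprod A N
  have inl_k_fst : biprod.inl ≫ k.hom ≫ biprod.fst = 𝟙 _ := by
    have map_s : biprod.inl ≫ e.hom = (toKaroubi D).map s := by simp [s]
    have k_fst : k.hom ≫ biprod.fst = e.hom ≫ (toKaroubi D).map (f.hom ≫ biprod.fst) := by
      simp only [k, Iso.trans_hom, Functor.mapIso_hom, Functor.mapBiprod_hom, Category.assoc,
        biprod.lift_fst, Functor.map_comp]
    rw [k_fst, reassoc_of% map_s, ← Functor.map_comp, reassoc_of% hf, biprod.inl_fst,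
      CategoryTheory.Functor.map_id]
  have : IsIso (biprod.inl ≫ k.hom ≫ biprod.fst) := by rw [inl_k_fst]; infer_instance
  exact ⟨N, ⟨(Biprod.isoElim k).symm⟩⟩

/-- The Eilenberg swindle: `P` is a complement of `Q' ⊞ R` in `Q ⊞ R`. -/
theorem IsWeaklyIdempotentComplete.essImage_toKaroubi_of_swindle
    (hD : IsWeaklyIdempotentComplete D) {P Q Q' R : Karoubi D} (e : Q ≅ P ⊞ Q')
    (hQ : (toKaroubi D).essImage (Q ⊞ R)) (hQ' : (toKaroubi D).essImage (Q' ⊞ R)) :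
    (toKaroubi D).essImage P := by
  obtain ⟨B, ⟨b⟩⟩ := hQ
  obtain ⟨A, ⟨a⟩⟩ := hQ'
  exact hD.essImage_toKaroubi (biprod.mapIso a (.refl P) ≪≫ biprod.braiding _ _ ≪≫
    (biprod.associator P Q' R).symm ≪≫ biprod.mapIso e.symm (.refl R) ≪≫ b.symm)

theorem isWeaklyIdempotentComplete_of_hasCokernels [HasCokernels D] :
    IsWeaklyIdempotentComplete D := by
  intro A B s _
  let e : B ≅ A ⊞ cokernel s := biprod.uniqueUpToIso _ _
    (isBilimitBinaryBiconeOfIsSplitMonoOfCokernel (cokernelIsCokernel s))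
  have e_fst : e.hom ≫ biprod.fst = retraction s := biprod.lift_fst _ _
  have e_snd : e.hom ≫ biprod.snd = cokernel.π s := biprod.lift_snd _ _
  exact ⟨_, e, by ext <;> simp [e_fst, e_snd]⟩

variable {C : Type*} [Category* C]

instance : (functorExtension₂ C D).Additive where

/-- An isomorphism of functors `F ≅ T ⊞ G` at an object of the Karoubi envelope. -/
noncomputable def karoubiBiprodIso {F T G : C ⥤ D} (e : F ≅ T ⊞ G) (P : Karoubi C) :
    ((functorExtension₂ C D).obj F).obj P ≅
      ((functorExtension₂ C D).obj T).obj P ⊞ ((functorExtension₂ C D).obj G).obj P :=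
  (functorExtension₂ C D ⋙ (evaluation _ _).obj P).mapIso e ≪≫
    (functorExtension₂ C D ⋙ (evaluation _ _).obj P).mapBiprod T G

/-- A decomposition of a functor `F` into a sum descends to the functors induced on a localized
category. -/
noncomputable def localizationBiprodIso {C' : Type*} [Category* C'] (L : C ⥤ C')
    (W : MorphismProperty C) [L.IsLocalization W] {F T G : C ⥤ D} (e : F ≅ T ⊞ G)
    (F' T' G' : C' ⥤ D) [Localization.Lifting L W F F'] [Localization.Lifting L W T T']
    [Localization.Lifting L W G G'] : F' ≅ T' ⊞ G' := by
  have := Localization.full_whiskeringLeft L W D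
  have := Localization.faithful_whiskeringLeft L W D
  exact ((Functor.whiskeringLeft C C' D).obj L).preimageIso
    (Localization.Lifting.iso L W F F' ≪≫ e ≪≫
      biprod.mapIso (Localization.Lifting.iso L W T T').symm
        (Localization.Lifting.iso L W G G').symm ≪≫
      (((Functor.whiskeringLeft C C' D).obj L).mapBiprod T' G').symm)

theorem isIso_map_of_iso_biprod {F T G : C ⥤ D} (e : F ≅ T ⊞ G) {X Y : C} (f : X ⟶ Y)
    [IsIso (T.map f)] [IsIso (G.map f)] : IsIso (F.map f) := by
  let e' (X : C) : F.obj X ≅ T.obj X ⊞ G.obj X :=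
    ((evaluation C D).obj X).mapIso e ≪≫ ((evaluation C D).obj X).mapBiprod T G
  have fst (X : C) : (e' X).hom ≫ biprod.fst = (e.hom ≫ biprod.fst).app X :=
    (Category.assoc _ _ _).trans (congrArg (_ ≫ ·) (biprod.lift_fst _ _))
  have snd (X : C) : (e' X).hom ≫ biprod.snd = (e.hom ≫ biprod.snd).app X :=
    (Category.assoc _ _ _).trans (congrArg (_ ≫ ·) (biprod.lift_snd _ _))
  have map_eq : F.map f = (e' X).hom ≫ biprod.map (T.map f) (G.map f) ≫ (e' Y).inv := by
    rw [← Category.assoc, Iso.eq_comp_inv]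
    ext
    · rw [Category.assoc, Category.assoc, biprod.map_fst, fst, reassoc_of% fst, NatTrans.naturality]
    · rw [Category.assoc, Category.assoc, biprod.map_snd, snd, reassoc_of% snd, NatTrans.naturality]
  have : IsIso (biprod.map (T.map f) (G.map f)) :=
    (biprod.mapIso (asIso (T.map f)) (asIso (G.map f))).isIso_hom
  rw [map_eq]
  infer_instance

end Swindle

section Stable

open HomotopicalAlgebra Idempotents

attribute [local instance] hasBinaryBiproducts_of_finite_biproducts
  preservesBinaryBiproducts_of_preservesBiproducts

theorem projective_sigma {J C : Type*} [Category* C] (Z : J → C) [HasCoproduct Z]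
    [∀ j, Projective (Z j)] : Projective (∐ Z) :=
  ⟨fun f e _ => ⟨Limits.Sigma.desc fun j => Projective.factorThru (Limits.Sigma.ι Z j ≫ f) e,
    Limits.Sigma.hom_ext _ _ fun j => by simp⟩⟩

theorem projective_sigma_id_obj {C : Type*} [Category* C] [HasCountableCoproducts C] (P : C)
    [Projective P] : Projective ((∐ fun _ : ℕ => 𝟭 C).obj P) :=
  Projective.of_iso (PreservesCoproduct.iso ((evaluation C C).obj P) fun _ : ℕ => 𝟭 C).symm
    (projective_sigma fun _ : ℕ => P)

section

variable {C : Type u} [Category.{v} C] [Preadditive C]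

variable (C) in
/-- The projection from a category to its stable category. -/
abbrev toStab : C ⥤ Stab C := Quotient.functor (stableRel C)

/-- The morphisms that become invertible in the stable category. -/
abbrev stableIsos (C : Type u) [Category.{v} C] [Preadditive C] : MorphismProperty C :=
  (MorphismProperty.isomorphisms (Stab C)).inverseImage (toStab C)

theorem stableIsos_isInvertedBy {C' : Type*} [Category* C'] [Preadditive C']
    (F : C ⥤ C') [F.Additive] (hF : ∀ P : C, Projective P → Projective (F.obj P)) :
    (stableIsos C).IsInvertedBy (F ⋙ toStab C') := fun _ _ f hf =>
  have : IsIso ((toStab C).map f) := hf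
  inferInstanceAs (IsIso ((Stab.map F hF).map ((toStab C).map f)))

variable [HasFiniteBiproducts C]

theorem isIso_toStab_map_biprod_fst (X P : C) [Projective P] :
    IsIso ((toStab C).map (biprod.fst : X ⊞ P ⟶ X)) := by
  refine ⟨(toStab C).map biprod.inl, ?_, ?_⟩
  · rw [← Functor.map_comp]
    refine CategoryTheory.Quotient.sound _ ⟨P, inferInstance, -biprod.snd, biprod.inr, ?_⟩
    change biprod.fst ≫ biprod.inl - 𝟙 (X ⊞ P) = _
    rw [← biprod.total, Preadditive.neg_comp, sub_add_cancel_left]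
  · rw [← Functor.map_comp, biprod.inl_fst, CategoryTheory.Functor.map_id]

/-- A morphism that factors through a projective object `P` is a homotopy with respect to the
cylinder `X ⊞ P`. -/
instance isLocalization_toStab : (toStab C).IsLocalization (stableIsos C) :=
  Quotient.isLocalization_functor _ _ (fun _ _ _ h => h) fun X _ f g ⟨P, _, i, q, h⟩ =>
    ⟨{ I := X ⊞ P, i₀ := biprod.lift (𝟙 X) i, i₁ := biprod.inl, π := biprod.fst },
      { h := biprod.desc g q
        h₀ := by rw [biprod.lift_desc, Category.id_comp, ← h, add_sub_cancel]
        h₁ := biprod.inl_desc _ _ }, isIso_toStab_map_biprod_fst X P⟩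

theorem stableRel_add ⦃X Y : C⦄ (f₁ f₂ g₁ g₂ : X ⟶ Y) (hf : stableRel C f₁ f₂)
    (hg : stableRel C g₁ g₂) : stableRel C (f₁ + g₁) (f₂ + g₂) := by
  obtain ⟨P, hP, i, q, h⟩ := hf
  obtain ⟨P', hP', i', q', h'⟩ := hg
  refine ⟨P ⊞ P', inferInstance, biprod.lift i i', biprod.desc q q', ?_⟩
  rw [biprod.lift_desc, ← h, ← h']
  abel

instance congruence_stableRel : Congruence (stableRel C) where
  equivalence :=
    { refl f := ⟨_, Projective.zero_projective, 0, 0, by simp⟩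
      symm := fun ⟨P, hP, i, q, h⟩ => ⟨P, hP, -i, q, by rw [Preadditive.neg_comp, ← h, neg_sub]⟩
      trans := fun hf hg => by
        obtain ⟨P, hP, i, q, h⟩ := stableRel_add _ _ _ _ hf hg
        exact ⟨P, hP, i, q, by rw [← h]; abel⟩ }
  comp_left f _ _ := fun ⟨P, hP, i, q, h⟩ => ⟨P, hP, f ≫ i, q, by
    rw [← Preadditive.comp_sub, h, Category.assoc]⟩
  comp_right f := fun ⟨P, hP, i, q, h⟩ => ⟨P, hP, i, q ≫ f, by
    rw [← Preadditive.sub_comp, h, Category.assoc]⟩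

noncomputable instance preadditiveStab : Preadditive (Stab C) :=
  Quotient.preadditive _ stableRel_add

instance : (toStab C).Additive := Quotient.functor_additive _ stableRel_add

instance hasFiniteBiproducts_stab : HasFiniteBiproducts (Stab C) :=
  ⟨fun _ => ⟨fun f => inferInstanceAs (HasBiproduct fun j => (toStab C).obj (f j).as)⟩⟩

theorem stab_map_additive {C' : Type*} [Category* C'] [Preadditive C'] [HasFiniteBiproducts C']
    (F : C ⥤ C') [F.Additive] (hF : ∀ P : C, Projective P → Projective (F.obj P)) :
    (Stab.map F hF).Additive where
  map_add := by
    rintro _ _ ⟨f⟩ ⟨g⟩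
    exact congrArg (toStab C').map F.map_add

theorem IsWeaklyIdempotentComplete.stab (hC : IsWeaklyIdempotentComplete C) :
    IsWeaklyIdempotentComplete (Stab C) := by
  rintro ⟨A⟩ ⟨B⟩ s _
  obtain ⟨s, rfl⟩ := (toStab C).map_surjective s
  obtain ⟨r, hr⟩ := (toStab C).map_surjective (retraction ((toStab C).map s))
  have map_s_comp_r : (toStab C).map (𝟙 A) = (toStab C).map (s ≫ r) := by
    rw [Functor.map_comp, hr, IsSplitMono.id, CategoryTheory.Functor.map_id]
  obtain ⟨P, _, i, q, h⟩ := (Quotient.functor_map_eq_iff _ _ _).1 map_s_comp_r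
  have : IsSplitMono (biprod.lift s i) := ⟨⟨{ retraction := biprod.desc r q, id := by simp [← h] }⟩⟩
  obtain ⟨N, e, he⟩ := hC (biprod.lift s i)
  have := isIso_toStab_map_biprod_fst B P
  let e' : (toStab C).obj B ≅ (toStab C).obj A ⊞ (toStab C).obj N :=
    (asIso ((toStab C).map biprod.fst)).symm ≪≫ (toStab C).mapIso e ≪≫ (toStab C).mapBiprod A N
  have map_s_comp_e' : (toStab C).map s ≫ e'.hom =
      (toStab C).map (biprod.lift s i ≫ e.hom) ≫ ((toStab C).mapBiprod A N).hom := by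
    have map_s_comp_inv : (toStab C).map s ≫ inv ((toStab C).map (biprod.fst : B ⊞ P ⟶ B)) =
        (toStab C).map (biprod.lift s i) := by
      rw [IsIso.comp_inv_eq, ← Functor.map_comp, biprod.lift_fst]
    rw [Functor.map_comp, Category.assoc, ← map_s_comp_inv, Category.assoc]
    rfl
  refine ⟨_, e', map_s_comp_e'.trans ?_⟩
  rw [he, ← Iso.eq_comp_inv, Functor.mapBiprod_inv]
  exact biprod.inl_desc _ _ |>.symm

variable [HasCountableCoproducts C]

instance additive_sigma_id : (∐ fun _ : ℕ => 𝟭 C).Additive where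
  map_add := colimit_obj_ext fun n => by
    simp [← NatTrans.naturality]

theorem isIdempotentComplete_stab (hC : IsWeaklyIdempotentComplete C) :
    IsIdempotentComplete (Stab C) := by
  let E : Stab C ⥤ Stab C :=
    Stab.map (∐ fun _ : ℕ => 𝟭 C) fun P _ => projective_sigma_id_obj P
  let e₀ : (∐ fun _ : ℕ => 𝟭 C) ⋙ toStab C ≅
      (𝟭 C ⋙ toStab C) ⊞ ((∐ fun _ : ℕ => 𝟭 C) ⋙ toStab C) :=
    ((Functor.whiskeringRight C C (Stab C)).obj (toStab C)).mapIso
      (sigmaIsoBiprod fun _ : ℕ => 𝟭 C) ≪≫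
      ((Functor.whiskeringRight C C (Stab C)).obj (toStab C)).mapBiprod _ _
  let _ : Localization.Lifting (toStab C) (stableIsos C)
    ((∐ fun _ : ℕ => 𝟭 C) ⋙ toStab C) E := ⟨Iso.refl _⟩
  let _ : Localization.Lifting (toStab C) (stableIsos C) (𝟭 C ⋙ toStab C) (𝟭 _) := ⟨Iso.refl _⟩
  let e : E ≅ 𝟭 _ ⊞ E := localizationBiprodIso (toStab C) (stableIsos C) e₀ E (𝟭 _) E
  refine isIdempotentComplete_of_essImage_toKaroubi fun P => ?_
  let Q := ((functorExtension₂ _ _).obj E).obj P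
  have decomposition : (toKaroubi (Stab C)).essImage (Q ⊞ Q.complement) :=
    ⟨_, ⟨(Karoubi.decomposition Q).symm⟩⟩
  exact hC.stab.essImage_toKaroubi_of_swindle (karoubiBiprodIso e P) decomposition decomposition

end

variable {G : Type t} [Group G] {X Y : GSets.{w} G}

section

variable {A : Type u} [Category.{v} A] [Preadditive A] [HasFiniteBiproducts A] (f : Y ⟶ X)

instance : (push (A := A) f).Additive := (repResPushAdjunction f).right_adjoint_additive

theorem projective_push (P : RepCat A Y) (hP : Projective P) : Projective ((push f).obj P) :=
  have := Functor.preservesEpimorphisms_of_adjunction (repResPushAdjunction (A := A) f)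
  (pushRepResAdjunction f).map_projective P hP

end

attribute [local instance] HasFiniteBiproducts.of_hasFiniteProducts

variable {k : Type u} [Field k]

variable (G k) in
/-- The strict transformation of presheaves from representations to stable categories. -/
def StrictMap.toStRep : StrictMap (Rep.{w} G (ModuleCat.{u} k)) (StRep.{w} G k) where
  app X := toStab (RepCat (ModuleCat.{u} k) X)
  naturality _ := rfl

theorem isAdditivePresheaf_stRep : IsAdditivePresheaf (StRep.{w} G k) :=
  ⟨fun X => inferInstanceAs (Preadditive (Stab (RepCat (ModuleCat.{u} k) X))),
    fun X => inferInstanceAs (HasFiniteProducts (Stab (RepCat (ModuleCat.{u} k) X))),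
    fun _ _ f => stab_map_additive (repRes _ f) (projective_repRes f)⟩

theorem isStrictStack_stRep [Finite G] (p : ℕ) [Fact p.Prime] [CharP k p] :
    IsStrictStack (StRep.{w} G k) (sippTopology G p) :=
  fun X U α hα => by
    obtain ⟨c⟩ := IsSippCovering.nonempty_fibreWeight hα fun _ => isUnit_natCast_of_charP
      (k := k)
    have : IsIdempotentComplete ((StRep.{w} G k).obj (op X)) :=
      isIdempotentComplete_stab (isWeaklyIdempotentComplete_of_hasCokernels
        (D := RepCat (ModuleCat.{u} k) X))
    have (X : GSets.{w} G) : ((StrictMap.toStRep G k).app X).IsLocalization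
        (stableIsos (RepCat (ModuleCat.{u} k) X)) :=
      isLocalization_toStab (C := RepCat (ModuleCat.{u} k) X)
    have isInvertedBy_push ⦃X Y : GSets.{w} G⦄ (f : Y ⟶ X) :
        (stableIsos (RepCat (ModuleCat.{u} k) Y)).IsInvertedBy (push f ⋙ toStab _) :=
      stableIsos_isInvertedBy (push f) (projective_push f)
    exact (StrictMap.toStRep G k).isEquivalence_comparison_of_isLocalization
      (fun X => stableIsos (RepCat (ModuleCat.{u} k) X))
      (push := fun _ _ f => push f) (fun _ _ f => repResPushAdjunction f)
      isInvertedBy_push α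
      (fun N => (isFibrewiseProduct_pushProj α N).isUniversalPushforward)
      c.unit_comp_transfer

end Stable

section Complexes

theorem isCouniversal_mapHomologicalComplex {C D : Type*} [Category* C] [Category* D]
    [Preadditive C] [Preadditive D] (F : C ⥤ D) [F.Additive] {ι : Type*} {c : ComplexShape ι}
    {P : HomologicalComplex C c} {N : HomologicalComplex D c}
    {ε : (F.mapHomologicalComplex c).obj P ⟶ N} (hε : ∀ i, IsCouniversal F (ε.f i)) :
    IsCouniversal (F.mapHomologicalComplex c) ε := fun T => by
  refine ⟨fun m m' h => HomologicalComplex.hom_ext _ _ fun i => (hε i _).injective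
    (HomologicalComplex.congr_hom h i), fun n => ?_⟩
  choose m hm using fun i => (hε i (T.X i)).surjective (n.f i)
  let ε' (i : ι) : F.obj (P.X i) ⟶ N.X i := ε.f i
  let n' (i : ι) : F.obj (T.X i) ⟶ N.X i := n.f i
  replace hm (i : ι) : F.map (m i) ≫ ε' i = n' i := hm i
  have comm (i j : ι) : F.map (m i ≫ P.d i j) ≫ ε' j = F.map (T.d i j ≫ m j) ≫ ε' j :=
    calc F.map (m i ≫ P.d i j) ≫ ε' j = F.map (m i) ≫ F.map (P.d i j) ≫ ε' j := by
          rw [F.map_comp, Category.assoc]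
      _ = F.map (m i) ≫ ε' i ≫ N.d i j := congrArg (_ ≫ ·) (ε.comm i j).symm
      _ = n' i ≫ N.d i j := by rw [← hm, Category.assoc]
      _ = F.map (T.d i j) ≫ n' j := n.comm i j
      _ = F.map (T.d i j ≫ m j) ≫ ε' j := by rw [F.map_comp, Category.assoc, hm]
  exact ⟨{ f := m, comm' := fun i j _ => (hε j _).injective (comm i j) },
    HomologicalComplex.hom_ext _ _ hm⟩

/-- The adjunction between functors on complexes induced degreewise by an adjunction. -/
def mapHomologicalComplexAdjunction {C D : Type*} [Category* C] [Category* D]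
    [Preadditive C] [Preadditive D] {F : C ⥤ D} {R : D ⥤ C} [F.Additive] [R.Additive]
    (adj : F ⊣ R) {ι : Type*} (c : ComplexShape ι) :
    F.mapHomologicalComplex c ⊣ R.mapHomologicalComplex c :=
  Adjunction.mkOfUnitCounit
    { unit := NatTrans.mapHomologicalComplex adj.unit c
      counit := NatTrans.mapHomologicalComplex adj.counit c
      left_triangle := by
        ext K i
        exact (congrArg _ (Category.id_comp _)).trans (adj.left_triangle_components (K.X i))
      right_triangle := by
        ext K i
        exact (congrArg _ (Category.id_comp _)).trans (adj.right_triangle_components (K.X i)) }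

variable {G : Type t} [Group G]

variable (G) in
/-- The presheaf of categories of cochain complexes of representations, with its restriction
functors applied degreewise. -/
def ChRep (A : Type u) [Category.{v} A] [Preadditive A] :
    (GSets.{w} G)ᵒᵖ ⥤ Cat.{max w v, max u v w t} where
  obj X := Cat.of (CochainComplex (RepCat A X.unop) ℤ)
  map α := ((repRes A α.unop).mapHomologicalComplex (ComplexShape.up ℤ)).toCatHom

section

variable {A : Type u} [Category.{v} A] [Preadditive A]

theorem baseChange_chRep_f {S X Y Z : GSets.{w} G} {f' : Z ⟶ S} {h' : Z ⟶ Y} {h : S ⟶ X}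
    {f : Y ⟶ X} (sq : f' ≫ h = h' ≫ f) {P : (ChRep.{w} G A).obj (op X)}
    {N : (ChRep.{w} G A).obj (op Y)} (ε : (res (ChRep.{w} G A) f).obj P ⟶ N) (i : ℤ) :
    HomologicalComplex.Hom.f (baseChange sq ε) i =
      baseChange (D := Rep.{w} G A) sq (HomologicalComplex.Hom.f ε i) := by
  refine (HomologicalComplex.comp_f _ _ i).trans ?_
  exact congrArg (· ≫ _) (HomologicalComplex.eqToHom_f _ i)

theorem IsUniversalPushforward.chRep {X Y : GSets.{w} G} {f : Y ⟶ X}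
    {P : (ChRep.{w} G A).obj (op X)} {N : (ChRep.{w} G A).obj (op Y)}
    {ε : (res (ChRep.{w} G A) f).obj P ⟶ N}
    (hε : ∀ i, IsUniversalPushforward (D := Rep.{w} G A) (HomologicalComplex.Hom.f ε i)) :
    IsUniversalPushforward ε := fun S Z f' h' h sq =>
  isCouniversal_mapHomologicalComplex (repRes A f') fun i => by
    rw [baseChange_chRep_f]
    exact hε i sq

end

section

attribute [local instance] Abelian.hasFiniteBiproducts

variable {A : Type u} [Category.{v} A] [Abelian A] {X Y : GSets.{w} G} (f : Y ⟶ X)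

instance : (push (A := A) f).PreservesHomology :=
  have := (repResPushAdjunction (A := A) f).rightAdjoint_preservesLimits
  have := (pushRepResAdjunction (A := A) f).leftAdjoint_preservesColimits
  inferInstance

theorem quasiIso_isInvertedBy_push :
    (HomologicalComplex.quasiIso (RepCat A Y) (ComplexShape.up ℤ)).IsInvertedBy
      ((push f).mapHomologicalComplex _ ⋙ MorphismProperty.Q
        (HomologicalComplex.quasiIso (RepCat A X) (ComplexShape.up ℤ))) :=
  fun _ _ φ (_ : QuasiIso φ) => MorphismProperty.Q_inverts _ _
    (HomologicalComplex.quasiIso_map_of_preservesHomology φ (push f))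

variable (G A) in
/-- The strict transformation of presheaves from cochain complexes to derived categories. -/
def StrictMap.toDerRep : StrictMap (ChRep.{w} G A) (DerRep.{w} G A) where
  app X := MorphismProperty.Q (HomologicalComplex.quasiIso (RepCat A X) (ComplexShape.up ℤ))
  naturality f := Der.fac (repRes A f)

theorem isEquivalence_comparison_derRep {p : ℕ} [Fact p.Prime] [Linear (ZLoc p) A] {α : Y ⟶ X}
    (hα : IsSippCovering p (Presieve.singleton α))
    [IsIdempotentComplete (Der (RepCat A X))] :
    (comparison (DerRep.{w} G A) α).IsEquivalence := by
  obtain ⟨c⟩ := IsSippCovering.nonempty_fibreWeight hα fun _ => isUnit_natCast_zLoc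
  have : IsIdempotentComplete ((DerRep.{w} G A).obj (op X)) :=
    inferInstanceAs (IsIdempotentComplete (Der (RepCat A X)))
  have (X : GSets.{w} G) : ((StrictMap.toDerRep G A).app X).IsLocalization
      (HomologicalComplex.quasiIso (RepCat A X) (ComplexShape.up ℤ)) :=
    inferInstanceAs ((MorphismProperty.Q
      (HomologicalComplex.quasiIso (RepCat A X) (ComplexShape.up ℤ))).IsLocalization _)
  have unit_comp_transfer : (mapHomologicalComplexAdjunction (repResPushAdjunction (A := A) α)
      (ComplexShape.up ℤ)).unit ≫ NatTrans.mapHomologicalComplex c.transfer _ = 𝟙 _ := by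
    ext K i : 3
    exact NatTrans.congr_app c.unit_comp_transfer (K.X i)
  exact (StrictMap.toDerRep G A).isEquivalence_comparison_of_isLocalization
    (fun X => HomologicalComplex.quasiIso (RepCat A X) (ComplexShape.up ℤ))
    (push := fun _ _ f => (push f).mapHomologicalComplex _)
    (fun _ _ f => mapHomologicalComplexAdjunction (repResPushAdjunction f) _)
    (fun _ _ f => quasiIso_isInvertedBy_push f) α
    (fun N => .chRep fun i => (isFibrewiseProduct_pushProj α (N.X i)).isUniversalPushforward)
    unit_comp_transfer

end

end Complexes

section Triangulated

open Idempotents Pretriangulated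

attribute [local instance] hasBinaryBiproducts_of_finite_biproducts

variable {D : Type*} [Category* D]

theorem exists_splitting_of_essImage_toKaroubi {P : Karoubi D} (hP : (toKaroubi D).essImage P) :
    ∃ (Y : D) (i : Y ⟶ P.X) (r : P.X ⟶ Y), i ≫ r = 𝟙 Y ∧ r ≫ i = P.p := by
  obtain ⟨Y, ⟨e⟩⟩ := hP
  exact ⟨Y, e.hom.f, e.inv.f, congrArg Karoubi.Hom.f e.hom_inv_id,
    congrArg Karoubi.Hom.f e.inv_hom_id⟩

variable [Preadditive D]

/-- For idempotents `e` and `e'` with `(e - e')² = 0` one has `e = e ≫ e' ≫ e`. -/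
theorem essImage_toKaroubi_of_sub_comp_sub_eq_zero {P : Karoubi D} {Y : D} (i : Y ⟶ P.X)
    (r : P.X ⟶ Y) (hir : i ≫ r = 𝟙 Y) (h : (P.p - r ≫ i) ≫ (P.p - r ≫ i) = 0) :
    (toKaroubi D).essImage P := by
  have p_eq : P.p ≫ r ≫ i ≫ P.p = P.p := by
    have := congrArg (P.p ≫ · ≫ P.p) h
    simpa [Preadditive.comp_sub, Preadditive.sub_comp, reassoc_of% hir, sub_eq_zero,
      eq_comm (a := P.p)] using this
  have id_eq : i ≫ P.p ≫ r = 𝟙 Y := by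
    have := congrArg (i ≫ · ≫ r) h
    simpa [Preadditive.comp_sub, Preadditive.sub_comp, hir, reassoc_of% hir, sub_eq_zero,
      eq_comm (a := 𝟙 Y)] using this
  exact ⟨Y, ⟨{ hom := ⟨i ≫ P.p, by simp⟩
               inv := ⟨P.p ≫ r, by simp⟩
               hom_inv_id := by ext; simp [id_eq]
               inv_hom_id := by ext; simp [p_eq] }⟩⟩

theorem essImage_toKaroubi_biprod [HasFiniteBiproducts D] {P Q : Karoubi D} {Z : D} {i₁ : P.X ⟶ Z}
    {p₁ : Z ⟶ P.X} {i₂ : Q.X ⟶ Z} {p₂ : Z ⟶ Q.X} (h₁₁ : i₁ ≫ p₁ = P.p) (h₁₂ : i₁ ≫ p₂ = 0)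
    (h₂₁ : i₂ ≫ p₁ = 0) (h₂₂ : i₂ ≫ p₂ = Q.p) (total : p₁ ≫ i₁ + p₂ ≫ i₂ = 𝟙 Z) :
    (toKaroubi D).essImage (P ⊞ Q) := by
  have comp_total {W : D} (k : W ⟶ Z) : k ≫ p₁ ≫ i₁ + k ≫ p₂ ≫ i₂ = k := by
    rw [← Preadditive.comp_add, total, Category.comp_id]
  have total_comp {W : D} (k : Z ⟶ W) : p₁ ≫ i₁ ≫ k + p₂ ≫ i₂ ≫ k = k := by
    rw [← Category.assoc, ← Category.assoc p₂, ← Preadditive.add_comp, total, Category.id_comp]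
  let b : BinaryBicone P Q :=
    { pt := (toKaroubi D).obj Z
      fst := ⟨p₁, by simpa [h₁₁, h₂₁] using total_comp p₁⟩
      snd := ⟨p₂, by simpa [h₁₂, h₂₂] using total_comp p₂⟩
      inl := ⟨i₁, by simpa [reassoc_of% h₁₁, reassoc_of% h₁₂] using comp_total i₁⟩
      inr := ⟨i₂, by simpa [reassoc_of% h₂₁, reassoc_of% h₂₂] using comp_total i₂⟩
      inl_fst := by ext; simp [h₁₁]
      inl_snd := by ext; simp [h₁₂]
      inr_fst := by ext; simp [h₂₁]
      inr_snd := by ext; simp [h₂₂] }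
  exact ⟨Z, ⟨biprod.uniqueUpToIso P Q (isBinaryBilimitOfTotal b (by ext; simp [b, total]))⟩⟩

variable [HasZeroObject D] [HasShift D ℤ] [∀ n : ℤ, (shiftFunctor D n).Additive]
  [Pretriangulated D]

theorem isWeaklyIdempotentComplete_of_pretriangulated : IsWeaklyIdempotentComplete D := by
  intro A B s _
  obtain ⟨N, g, h, hT⟩ := distinguished_cocone_triangle s
  obtain ⟨e, he, -⟩ := exists_iso_binaryBiproduct_of_distTriang _ hT
    (Triangle.mor₃_eq_zero_of_mono₁ _ hT (inferInstanceAs (Mono s)))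
  exact ⟨N, e, he⟩

theorem comp_eq_zero_of_distTriang {T : Triangle D} (hT : T ∈ distTriang D) {X Z : D}
    {n : X ⟶ T.obj₂} {n' : T.obj₂ ⟶ Z} (hn : n ≫ T.mor₂ = 0) (hn' : T.mor₁ ≫ n' = 0) :
    n ≫ n' = 0 := by
  obtain ⟨q, rfl⟩ := Triangle.coyoneda_exact₂ _ hT n hn
  rw [Category.assoc, hn', comp_zero]

theorem isIso_of_distTriang {T : Triangle D} (hT : T ∈ distTriang D) {k : T.obj₂ ⟶ T.obj₂}
    (h₁ : T.mor₁ ≫ k = T.mor₁) (h₂ : k ≫ T.mor₂ = T.mor₂) : IsIso k := by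
  let φ : T ⟶ T := { hom₁ := 𝟙 _, hom₂ := k, hom₃ := 𝟙 _ }
  exact isIso₂_of_isIso₁₃ φ hT hT (inferInstanceAs (IsIso (𝟙 _))) (inferInstanceAs (IsIso (𝟙 _)))

theorem exists_splitting_of_distTriang {T : Triangle D} (hT : T ∈ distTriang D) (φ : T ⟶ T)
    {Y₁ Y₃ : D} {i₁ : Y₁ ⟶ T.obj₁} {r₁ : T.obj₁ ⟶ Y₁} (hir₁ : i₁ ≫ r₁ = 𝟙 Y₁)
    (hri₁ : r₁ ≫ i₁ = φ.hom₁) {i₃ : Y₃ ⟶ T.obj₃} {r₃ : T.obj₃ ⟶ Y₃} (hir₃ : i₃ ≫ r₃ = 𝟙 Y₃)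
    (hri₃ : r₃ ≫ i₃ = φ.hom₃) :
    ∃ (Y : D) (i : Y ⟶ T.obj₂) (r : T.obj₂ ⟶ Y), i ≫ r = 𝟙 Y ∧
      T.mor₁ ≫ r ≫ i = φ.hom₁ ≫ T.mor₁ ∧ (r ≫ i) ≫ T.mor₂ = T.mor₂ ≫ φ.hom₃ := by
  obtain ⟨Y, y₁, y₃, hS⟩ := distinguished_cocone_triangle₂ (i₃ ≫ T.mor₃ ≫ r₁⟦(1 : ℤ)⟧')
  have comm₃ : T.mor₃ ≫ r₁⟦(1 : ℤ)⟧' ≫ i₁⟦(1 : ℤ)⟧' = r₃ ≫ i₃ ≫ T.mor₃ := by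
    rw [← Functor.map_comp, hri₁, reassoc_of% hri₃, φ.comm₃]
  have comm_i : (i₃ ≫ T.mor₃ ≫ r₁⟦(1 : ℤ)⟧') ≫ i₁⟦(1 : ℤ)⟧' = i₃ ≫ T.mor₃ := by
    rw [Category.assoc, Category.assoc, comm₃, reassoc_of% hir₃]
  have comm_r : T.mor₃ ≫ r₁⟦(1 : ℤ)⟧' = r₃ ≫ i₃ ≫ T.mor₃ ≫ r₁⟦(1 : ℤ)⟧' := by
    rw [← reassoc_of% comm₃, ← Functor.map_comp, hir₁, CategoryTheory.Functor.map_id,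
      Category.comp_id]
  obtain ⟨a, ha₁, ha₂⟩ : ∃ a : Y ⟶ T.obj₂, y₁ ≫ a = i₁ ≫ T.mor₁ ∧ y₃ ≫ i₃ = a ≫ T.mor₂ :=
    complete_distinguished_triangle_morphism₂ _ _ hS hT i₁ i₃ comm_i
  obtain ⟨b, hb₁, hb₂⟩ : ∃ b : T.obj₂ ⟶ Y, T.mor₁ ≫ b = r₁ ≫ y₁ ∧ T.mor₂ ≫ r₃ = b ≫ y₃ :=
    complete_distinguished_triangle_morphism₂ _ _ hT hS r₁ r₃ comm_r
  have y₁_comp : y₁ ≫ a ≫ b = y₁ := by rw [reassoc_of% ha₁, hb₁, reassoc_of% hir₁]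
  have comp_y₃ : (a ≫ b) ≫ y₃ = y₃ := by
    rw [Category.assoc, ← hb₂, ← reassoc_of% ha₂, hir₃, Category.comp_id]
  have : IsIso (a ≫ b) := isIso_of_distTriang hS y₁_comp comp_y₃
  refine ⟨Y, a, b ≫ inv (a ≫ b), by rw [← Category.assoc, IsIso.hom_inv_id], ?_, ?_⟩
  · have y₁_comp_inv : y₁ ≫ inv (a ≫ b) = y₁ := by rw [IsIso.comp_inv_eq, y₁_comp]
    rw [Category.assoc, reassoc_of% hb₁, reassoc_of% y₁_comp_inv, ha₁, reassoc_of% hri₁]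
  · have inv_comp_y₃ : inv (a ≫ b) ≫ y₃ = y₃ := by rw [IsIso.inv_comp_eq, comp_y₃]
    rw [Category.assoc, Category.assoc, ← ha₂, reassoc_of% inv_comp_y₃, ← reassoc_of% hb₂, hri₃]

theorem essImage_toKaroubi_of_distTriang {P : Karoubi (Triangle D)} (hP : P.X ∈ distTriang D)
    (h₁ : (toKaroubi D).essImage (((functorExtension₂ _ _).obj Triangle.π₁).obj P))
    (h₃ : (toKaroubi D).essImage (((functorExtension₂ _ _).obj Triangle.π₃).obj P)) :
    (toKaroubi D).essImage (((functorExtension₂ _ _).obj Triangle.π₂).obj P) := by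
  obtain ⟨Y₁, i₁, r₁, hir₁, hri₁⟩ := exists_splitting_of_essImage_toKaroubi h₁
  obtain ⟨Y₃, i₃, r₃, hir₃, hri₃⟩ := exists_splitting_of_essImage_toKaroubi h₃
  obtain ⟨Y, i, r, hir, comm₁, comm₂⟩ :=
    exists_splitting_of_distTriang hP P.p hir₁ hri₁ hir₃ hri₃
  refine essImage_toKaroubi_of_sub_comp_sub_eq_zero i r hir
    (comp_eq_zero_of_distTriang hP (n := P.p.hom₂ - r ≫ i) (n' := P.p.hom₂ - r ≫ i) ?_ ?_)
  · rw [Preadditive.sub_comp, comm₂, P.p.comm₂, sub_self]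
  · rw [Preadditive.comp_sub, comm₁, P.p.comm₁, sub_self]

/-- If `P` is the image of an idempotent `f`, the cone of `1 - f` is the sum of `P` and its
shift. -/
theorem essImage_toKaroubi_biprod_shift_one (P : Karoubi D) : (toKaroubi D).essImage
    (P ⊞ ((functorExtension₂ D D).obj (shiftFunctor D (1 : ℤ))).obj P) := by
  obtain ⟨Y, f, hf⟩ := P
  obtain ⟨Z, g, h, hT⟩ := distinguished_cocone_triangle (𝟙 Y - f)
  have f_comp_g : f ≫ g = g := by
    have : (𝟙 Y - f) ≫ g = 0 := comp_distTriang_mor_zero₁₂ _ hT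
    rwa [Preadditive.sub_comp, Category.id_comp, sub_eq_zero, eq_comm] at this
  have g_comp_h : g ≫ h = 0 := comp_distTriang_mor_zero₂₃ _ hT
  have h_comp_f : h ≫ f⟦(1 : ℤ)⟧' = h := by
    have : h ≫ (𝟙 Y - f)⟦(1 : ℤ)⟧' = 0 := comp_distTriang_mor_zero₃₁ _ hT
    rwa [Functor.map_sub, Preadditive.comp_sub, CategoryTheory.Functor.map_id, Category.comp_id,
      sub_eq_zero, eq_comm] at this
  obtain ⟨p, g_comp_p, p_comp_f⟩ : ∃ p : Z ⟶ Y, g ≫ p = f ∧ p ≫ f = p := by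
    obtain ⟨k, hk⟩ : ∃ k : Z ⟶ Y, f = g ≫ k := Triangle.yoneda_exact₂ _ hT f
      (show (𝟙 Y - f) ≫ f = 0 by rw [Preadditive.sub_comp, hf, Category.id_comp, sub_self])
    exact ⟨k ≫ f, by rw [← Category.assoc, ← hk, hf], by rw [Category.assoc, hf]⟩
  obtain ⟨l, hl⟩ : ∃ l : Y⟦(1 : ℤ)⟧ ⟶ Z, f⟦(1 : ℤ)⟧' = l ≫ h := Triangle.coyoneda_exact₁ _ hT _
    (show f⟦(1 : ℤ)⟧' ≫ (𝟙 Y - f)⟦(1 : ℤ)⟧' = 0 by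
      rw [← Functor.map_comp, Preadditive.comp_sub, hf, Category.comp_id, sub_self,
        Functor.map_zero])
  obtain ⟨m, hm⟩ : ∃ m : Y⟦(1 : ℤ)⟧ ⟶ Z, 𝟙 Z - p ≫ g = h ≫ m := Triangle.yoneda_exact₃ _ hT _
    (show g ≫ (𝟙 Z - p ≫ g) = 0 by
      rw [Preadditive.comp_sub, reassoc_of% g_comp_p, f_comp_g, Category.comp_id, sub_self])
  let i : Y⟦(1 : ℤ)⟧ ⟶ Z := f⟦(1 : ℤ)⟧' ≫ m
  have i_eq : i = l ≫ (𝟙 Z - p ≫ g) := by rw [hm, ← Category.assoc, ← hl]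
  have i_comp_p : i ≫ p = 0 := by simp [i_eq, Preadditive.sub_comp, g_comp_p, p_comp_f]
  have i_comp_h : i ≫ h = f⟦(1 : ℤ)⟧' := by simp [i_eq, Preadditive.sub_comp, g_comp_h, hl]
  have total : p ≫ g + h ≫ i = 𝟙 Z := by
    simp only [i]
    rw [reassoc_of% h_comp_f, ← hm, add_sub_cancel]
  exact essImage_toKaroubi_biprod g_comp_p g_comp_h i_comp_p i_comp_h total

theorem essImage_toKaroubi_biprod_shift {ε : ℤ} (hε : ε * ε = 1) (P : Karoubi D) :
    (toKaroubi D).essImage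
      (P ⊞ ((functorExtension₂ D D).obj (shiftFunctor D ε)).obj P) := by
  obtain rfl | rfl := mul_self_eq_one_iff.1 hε
  · exact essImage_toKaroubi_biprod_shift_one P
  · have e : ((functorExtension₂ D D).obj (shiftFunctor D (1 : ℤ))).obj
        (((functorExtension₂ D D).obj (shiftFunctor D (-1 : ℤ))).obj P) ≅ P :=
      ((functorExtension₂ D D).mapIso (shiftFunctorCompIsoId D (-1 : ℤ) 1 (by simp))).app P
    exact (toKaroubi D).essImage.prop_of_iso
      (biprod.mapIso (Iso.refl _) e ≪≫ biprod.braiding _ _) (essImage_toKaroubi_biprod_shift_one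
        (((functorExtension₂ D D).obj (shiftFunctor D (-1 : ℤ))).obj P))

end Triangulated

section OrbitSums

attribute [local instance] hasBinaryBiproducts_of_finite_biproducts
  preservesBinaryBiproducts_of_preservesBiproducts HasFiniteBiproducts.of_hasFiniteProducts

/-- The functors `T`, `T ⋙ S`, `T ⋙ S ⋙ S`, …; the coproduct of this sequence is the object on
which the Eilenberg swindle is performed. -/
def orbit {K : Type*} [Category* K] (S T : K ⥤ K) : ℕ → K ⥤ K
  | 0 => T
  | n + 1 => orbit S T n ⋙ S

theorem hasCoproduct_shifted_orbit {K : Type*} [Category* K] (S T : K ⥤ K) [S.IsEquivalence]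
    [HasCoproduct (orbit S T)] : HasCoproduct fun n => orbit S T (n + 1) :=
  ⟨⟨⟨_, isColimitOfHasCoproductOfPreservesColimit ((Functor.whiskeringRight K K K).obj S)
    (orbit S T)⟩⟩⟩

/-- The coproduct `F` of the orbit of `T` satisfies `F ≅ T ⊞ (F ⋙ S)`. -/
noncomputable def orbitSumIso {K : Type*} [Category* K] [Preadditive K] [HasFiniteBiproducts K]
    (S T : K ⥤ K) [S.IsEquivalence] [HasCoproduct (orbit S T)] :
    ∐ orbit S T ≅ T ⊞ (∐ orbit S T) ⋙ S :=
  have : HasCoproduct fun n => orbit S T (n + 1) := hasCoproduct_shifted_orbit S T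
  have : HasCoproduct fun n => ((Functor.whiskeringRight K K K).obj S).obj (orbit S T n) := this
  sigmaIsoBiprod (orbit S T) ≪≫ biprod.mapIso (Iso.refl _)
    (PreservesCoproduct.iso ((Functor.whiskeringRight K K K).obj S) (orbit S T)).symm

theorem hasCoproduct_of_isZero {C : Type*} [Category* C] [HasZeroMorphisms C]
    [HasFiniteCoproducts C] (Z : ℕ → C) (N : ℕ) (hZ : ∀ n, N ≤ n → IsZero (Z n)) :
    HasCoproduct Z := by
  let ι (n : ℕ) : Z n ⟶ ∐ fun i : Fin N => Z i :=
    if h : n < N then Limits.Sigma.ι (fun i : Fin N => Z i) ⟨n, h⟩ else 0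
  have ι_fin (i : Fin N) : ι i = Limits.Sigma.ι (fun i : Fin N => Z i) i := dif_pos i.2
  have ι_desc (s : Cofan Z) (n : ℕ) :
      ι n ≫ Limits.Sigma.desc (fun i : Fin N => s.inj i) = s.inj n := by
    by_cases h : n < N
    · exact (congrArg (· ≫ _) (ι_fin ⟨n, h⟩)).trans (Limits.Sigma.ι_desc _ _)
    · exact (hZ n (not_lt.1 h)).eq_of_src _ _
  have ι_hom_ext {W : C} (f g : (∐ fun i : Fin N => Z i) ⟶ W) (h : ∀ n, ι n ≫ f = ι n ≫ g) :
      f = g :=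
    Limits.Sigma.hom_ext f g fun i => by rw [← ι_fin, h]
  exact ⟨⟨⟨Cofan.mk _ ι, Cofan.IsColimit.mk _ _ ι_desc fun s m hm =>
    ι_hom_ext m _ fun n => (hm n).trans (ι_desc s n).symm⟩⟩⟩

variable {C : Type u} [Category.{v} C] [Abelian C]

variable (C) in
/-- The shift by `2ε` on complexes, as a composition of two shifts by `ε`. -/
abbrev shiftTwice (ε : ℤ) : CochainComplex C ℤ ⥤ CochainComplex C ℤ :=
  shiftFunctor _ ε ⋙ shiftFunctor _ ε

variable {ε : ℤ} {T : CochainComplex C ℤ ⥤ CochainComplex C ℤ}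

theorem isZero_orbit_shiftTwice (hε : ε * ε = 1) (hT : ∀ K i, 0 < ε * i → IsZero ((T.obj K).X i))
    (K : CochainComplex C ℤ) (n : ℕ) (i : ℤ) (hi : 0 < ε * i + 2 * n) :
    IsZero (((orbit (shiftTwice C ε) T n).obj K).X i) := by
  induction n generalizing i with
  | zero => exact hT K i (by simpa using hi)
  | succ n ih =>
    refine ih (i + ε + ε) ?_
    have : ε * (i + ε + ε) = ε * i + 2 := by linear_combination 2 * hε
    push_cast at hi
    linarith

theorem hasColimit_orbit_shiftTwice_eval (hε : ε * ε = 1)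
    (hT : ∀ K i, 0 < ε * i → IsZero ((T.obj K).X i)) (K : CochainComplex C ℤ) (i : ℤ) :
    HasColimit ((Discrete.functor (orbit (shiftTwice C ε) T)).flip.obj K ⋙
      HomologicalComplex.eval C (ComplexShape.up ℤ) i) := by
  have : HasCoproduct fun n => ((orbit (shiftTwice C ε) T n).obj K).X i :=
    hasCoproduct_of_isZero _ ((-(ε * i)).toNat + 1) fun n hn =>
      isZero_orbit_shiftTwice hε hT K n i (by omega)
  let e : (Discrete.functor (orbit (shiftTwice C ε) T)).flip.obj K ⋙
      HomologicalComplex.eval C (ComplexShape.up ℤ) i ≅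
        Discrete.functor fun n => ((orbit (shiftTwice C ε) T n).obj K).X i :=
    Discrete.natIso fun _ => Iso.refl _
  exact hasColimit_of_iso e

theorem hasCoproduct_orbit_shiftTwice (hε : ε * ε = 1)
    (hT : ∀ K i, 0 < ε * i → IsZero ((T.obj K).X i)) : HasCoproduct (orbit (shiftTwice C ε) T) := by
  have := hasColimit_orbit_shiftTwice_eval hε hT
  infer_instance

variable [HasCoproduct (orbit (shiftTwice C ε) T)]

theorem isZero_sigma_orbit_shiftTwice (hε : ε * ε = 1)
    (hT : ∀ K i, 0 < ε * i → IsZero ((T.obj K).X i)) (K : CochainComplex C ℤ) (i : ℤ)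
    (hi : 0 < ε * i) : IsZero (((∐ orbit (shiftTwice C ε) T).obj K).X i) := by
  have := hasColimit_orbit_shiftTwice_eval hε hT
  rw [IsZero.iff_id_eq_zero]
  have : PreservesColimit (Discrete.functor (orbit (shiftTwice C ε) T) ⋙ (evaluation _ _).obj K)
      (HomologicalComplex.eval C (ComplexShape.up ℤ) i) :=
    inferInstanceAs (PreservesColimit ((Discrete.functor (orbit (shiftTwice C ε) T)).flip.obj K) _)
  refine (isColimitOfPreserves ((evaluation _ _).obj K ⋙ HomologicalComplex.eval C _ i)
    (coproductIsCoproduct (orbit (shiftTwice C ε) T))).hom_ext fun ⟨n⟩ => ?_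
  exact (isZero_orbit_shiftTwice hε hT K n i (by omega)).eq_of_src _ _

/-- Homology in degrees `i` with `0 < ε * i` is zero, and `F ≅ T ⊞ F⟦2ε⟧` propagates the claim to
the other degrees. -/
theorem quasiIso_sigma_orbit_map (hε : ε * ε = 1)
    (hT : ∀ K i, 0 < ε * i → IsZero ((T.obj K).X i)) {K L : CochainComplex C ℤ} (f : K ⟶ L)
    [QuasiIso (T.map f)] : QuasiIso ((∐ orbit (shiftTwice C ε) T).map f) := by
  let F := ∐ orbit (shiftTwice C ε) T
  have quasiIsoAt (m : ℕ) (i : ℤ) (hi : 0 < ε * i + 2 * m) : QuasiIsoAt (F.map f) i := by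
    induction m generalizing i with
    | zero =>
      have exactAt (K : CochainComplex C ℤ) : (F.obj K).ExactAt i :=
        ShortComplex.exact_of_isZero_X₂ _
          (isZero_sigma_orbit_shiftTwice hε hT K i (by simpa using hi))
      exact (quasiIsoAt_iff_exactAt _ _ (exactAt K)).2 (exactAt L)
    | succ m ih =>
      have quasiIsoAt_shift : QuasiIsoAt ((F ⋙ shiftTwice C ε).map f) i := by
        refine (CochainComplex.quasiIsoAt_shift_iff _ _ _ _ rfl).2
          ((CochainComplex.quasiIsoAt_shift_iff _ _ _ _ rfl).2 (ih _ ?_))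
        have : ε * (ε + (ε + i)) = ε * i + 2 := by linear_combination 2 * hε
        push_cast at hi
        linarith
      let H := HomologicalComplex.homologyFunctor C (ComplexShape.up ℤ) i
      let e : F ⋙ H ≅ (T ⋙ H) ⊞ (F ⋙ shiftTwice C ε) ⋙ H :=
        ((Functor.whiskeringRight _ _ _).obj H).mapIso (orbitSumIso (shiftTwice C ε) T) ≪≫
          ((Functor.whiskeringRight _ _ _).obj H).mapBiprod _ _
      have : IsIso ((T ⋙ H).map f) :=
        inferInstanceAs (IsIso (HomologicalComplex.homologyMap (T.map f) i))
      have : IsIso (((F ⋙ shiftTwice C ε) ⋙ H).map f) :=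
        (quasiIsoAt_iff_isIso_homologyMap _ _).1 quasiIsoAt_shift
      exact (quasiIsoAt_iff_isIso_homologyMap _ _).2 (isIso_map_of_iso_biprod e f)
  exact ⟨fun i => quasiIsoAt ((-(ε * i)).toNat + 1) i (by omega)⟩

end OrbitSums

section DerivedCategory

open Idempotents Pretriangulated

attribute [local instance] hasBinaryBiproducts_of_finite_biproducts
  preservesBinaryBiproducts_of_preservesBiproducts HasFiniteBiproducts.of_hasFiniteProducts

variable {C : Type u} [Category.{v} C] [Abelian C] [HasDerivedCategory.{w} C]

variable (C) in
/-- The localization functor commutes with the shift by `2ε`. -/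
noncomputable def shiftTwiceCompQIso (ε : ℤ) :
    shiftTwice C ε ⋙ DerivedCategory.Q ≅ DerivedCategory.Q ⋙
      shiftFunctor (DerivedCategory C) ε ⋙ shiftFunctor (DerivedCategory C) ε :=
  Functor.isoWhiskerLeft (shiftFunctor (CochainComplex C ℤ) ε) (DerivedCategory.Q.commShiftIso ε) ≪≫
    Functor.isoWhiskerRight (DerivedCategory.Q.commShiftIso ε) (shiftFunctor (DerivedCategory C) ε)

variable {T : CochainComplex C ℤ ⥤ CochainComplex C ℤ}

theorem isInvertedBy_comp_Q (hTq : ∀ {K L} (f : K ⟶ L) [QuasiIso f], QuasiIso (T.map f)) :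
    (HomologicalComplex.quasiIso C (ComplexShape.up ℤ)).IsInvertedBy
      (T ⋙ (DerivedCategory.Q : _ ⥤ DerivedCategory C)) := fun _ _ f (_ : QuasiIso f) =>
  have := hTq f
  inferInstanceAs (IsIso (DerivedCategory.Q.map (T.map f)))

/-- The endofunctor of the derived category induced by a functor that preserves
quasi-isomorphisms. -/
noncomputable abbrev derivedLift
    (hTq : ∀ {K L} (f : K ⟶ L) [QuasiIso f], QuasiIso (T.map f)) :
    DerivedCategory C ⥤ DerivedCategory C :=
  Localization.lift (T ⋙ DerivedCategory.Q) (isInvertedBy_comp_Q hTq) DerivedCategory.Q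

theorem essImage_toKaroubi_derivedLift {ε : ℤ} (hε : ε * ε = 1)
    (hT : ∀ K i, 0 < ε * i → IsZero ((T.obj K).X i))
    (hTq : ∀ {K L} (f : K ⟶ L) [QuasiIso f], QuasiIso (T.map f))
    (P : Karoubi (DerivedCategory C)) :
    (toKaroubi _).essImage (((functorExtension₂ _ _).obj (derivedLift hTq)).obj P) := by
  have := hasCoproduct_orbit_shiftTwice hε hT
  let F := ∐ orbit (shiftTwice C ε) T
  have hFq {K L : CochainComplex C ℤ} (f : K ⟶ L) [QuasiIso f] : QuasiIso (F.map f) :=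
    have := hTq f
    quasiIso_sigma_orbit_map hε hT f
  let Q : CochainComplex C ℤ ⥤ DerivedCategory C := DerivedCategory.Q
  let s := shiftFunctor (DerivedCategory C) ε
  let e₀ : F ⋙ Q ≅ (T ⋙ Q) ⊞ (F ⋙ Q) ⋙ s ⋙ s :=
    ((Functor.whiskeringRight _ _ _).obj Q).mapIso (orbitSumIso (shiftTwice C ε) T) ≪≫
      ((Functor.whiskeringRight _ _ _).obj Q).mapBiprod _ _ ≪≫
      biprod.mapIso (Iso.refl _) (Functor.isoWhiskerLeft F (shiftTwiceCompQIso C ε))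
  let F' := derivedLift hFq
  let e : F' ≅ derivedLift hTq ⊞ F' ⋙ s ⋙ s :=
    localizationBiprodIso Q (HomologicalComplex.quasiIso C (ComplexShape.up ℤ)) e₀ _ _ _
  let F'P := ((functorExtension₂ _ _).obj F').obj P
  let F'Ps := ((functorExtension₂ _ _).obj s).obj F'P
  let F'Pss := ((functorExtension₂ _ _).obj s).obj F'Ps
  have hF'Pss : (toKaroubi _).essImage (F'Pss ⊞ F'Ps) :=
    (toKaroubi _).essImage.prop_of_iso (biprod.braiding _ _)
      (essImage_toKaroubi_biprod_shift hε F'Ps)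
  exact isWeaklyIdempotentComplete_of_pretriangulated.essImage_toKaroubi_of_swindle
    (karoubiBiprodIso e P) (essImage_toKaroubi_biprod_shift hε F'P) hF'Pss

/-- An isomorphism that commutes with idempotents is an isomorphism in the Karoubi envelope. -/
def karoubiIsoMk {D : Type*} [Category* D] {P Q : Karoubi D} (e : P.X ≅ Q.X)
    (h : P.p ≫ e.hom = e.hom ≫ Q.p) : P ≅ Q where
  hom := ⟨P.p ≫ e.hom, by simp [← h]⟩
  inv := ⟨Q.p ≫ e.inv, by simp [← cancel_epi e.hom, ← reassoc_of% h]⟩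
  hom_inv_id := by ext; simp [← reassoc_of% h]
  inv_hom_id := by ext; simp [h]

theorem essImage_toKaroubi_of_isLE (P : Karoubi (DerivedCategory C)) (hP : P.X.IsLE 0) :
    (toKaroubi _).essImage P := by
  let T := (ComplexShape.embeddingUpIntLE 0).truncLEFunctor C
  have hTq {K L : CochainComplex C ℤ} (f : K ⟶ L) [QuasiIso f] : QuasiIso (T.map f) :=
    (CochainComplex.quasiIso_truncLEMap_iff f 0).2 fun _ _ => inferInstance
  have hT (K : CochainComplex C ℤ) (i : ℤ) (hi : 0 < 1 * i) : IsZero ((T.obj K).X i) :=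
    CochainComplex.isZero_of_isStrictlyLE (K.truncLE 0) 0 i (by simpa using hi)
  let Q : CochainComplex C ℤ ⥤ DerivedCategory C := DerivedCategory.Q
  let τ : T ⋙ Q ⟶ Q := Functor.whiskerRight ((ComplexShape.embeddingUpIntLE 0).ιTruncLENatTrans C) Q
  let τ' : derivedLift hTq ⟶ 𝟭 _ :=
    Localization.liftNatTrans Q (HomologicalComplex.quasiIso C (ComplexShape.up ℤ)) _ _ _ _ τ
  have : IsIso (τ'.app P.X) := by
    obtain ⟨K, _, ⟨j⟩⟩ := DerivedCategory.exists_iso_Q_obj_of_isLE P.X 0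
    have : IsIso (τ.app K) := inferInstanceAs (IsIso (Q.map (K.ιTruncLE 0)))
    rw [NatTrans.isIso_app_iff_of_iso τ' j, Localization.liftNatTrans_app]
    infer_instance
  let e : (derivedLift hTq).obj P.X ≅ P.X := asIso (τ'.app P.X)
  exact (toKaroubi _).essImage.prop_of_iso (karoubiIsoMk e (τ'.naturality P.p))
    (essImage_toKaroubi_derivedLift (by simp) hT hTq P)

theorem essImage_toKaroubi_of_isGE (P : Karoubi (DerivedCategory C)) (hP : P.X.IsGE 0) :
    (toKaroubi _).essImage P := by
  let T := (ComplexShape.embeddingUpIntGE 0).truncGEFunctor C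
  have hTq {K L : CochainComplex C ℤ} (f : K ⟶ L) [QuasiIso f] : QuasiIso (T.map f) :=
    (CochainComplex.quasiIso_truncGEMap_iff f 0).2 fun _ _ => inferInstance
  have hT (K : CochainComplex C ℤ) (i : ℤ) (hi : 0 < -1 * i) : IsZero ((T.obj K).X i) :=
    CochainComplex.isZero_of_isStrictlyGE (K.truncGE 0) 0 i (by simpa using hi)
  let Q : CochainComplex C ℤ ⥤ DerivedCategory C := DerivedCategory.Q
  let τ : Q ⟶ T ⋙ Q := Functor.whiskerRight ((ComplexShape.embeddingUpIntGE 0).πTruncGENatTrans C) Q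
  let τ' : 𝟭 _ ⟶ derivedLift hTq :=
    Localization.liftNatTrans Q (HomologicalComplex.quasiIso C (ComplexShape.up ℤ)) _ _ _ _ τ
  have : IsIso (τ'.app P.X) := by
    obtain ⟨K, _, ⟨j⟩⟩ := DerivedCategory.exists_iso_Q_obj_of_isGE P.X 0
    have : IsIso (τ.app K) := inferInstanceAs (IsIso (Q.map (K.πTruncGE 0)))
    rw [NatTrans.isIso_app_iff_of_iso τ' j, Localization.liftNatTrans_app]
    infer_instance
  let e : P.X ≅ (derivedLift hTq).obj P.X := asIso (τ'.app P.X)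
  exact (toKaroubi _).essImage.prop_of_iso (karoubiIsoMk e (τ'.naturality P.p)).symm
    (essImage_toKaroubi_derivedLift (by simp) hT hTq P)

variable (C) in
theorem isIdempotentComplete_derivedCategory : IsIdempotentComplete (DerivedCategory C) :=
  isIdempotentComplete_of_essImage_toKaroubi fun P =>
    let t : Triangulated.TStructure (DerivedCategory C) := DerivedCategory.TStructure.t
    have isLE : ((t.truncLT 0).obj P.X).IsLE 0 := t.isLE_truncLT_obj P.X 0 0
    have isGE : ((t.truncGE 0).obj P.X).IsGE 0 := t.isGE_truncGE_obj P.X 0 0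
    essImage_toKaroubi_of_distTriang
      (P := ((functorExtension₂ _ _).obj (t.triangleLTGE 0)).obj P)
      (t.triangleLTGE_distinguished 0 P.X)
      (essImage_toKaroubi_of_isLE _ isLE) (essImage_toKaroubi_of_isGE _ isGE)

end DerivedCategory

section

variable {C : Type u} [Category.{v} C] [Abelian C]

noncomputable instance : Preadditive (Der C) :=
  @DerivedCategory.instPreadditive C _ _ (HasDerivedCategory.standard C)

instance : HasFiniteProducts (Der C) :=
  let := HasDerivedCategory.standard C
  inferInstanceAs (HasFiniteProducts (DerivedCategory C))

instance : IsIdempotentComplete (Der C) :=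
  let := HasDerivedCategory.standard C
  isIdempotentComplete_derivedCategory C

theorem der_map_additive {C' : Type*} [Category* C'] [Abelian C'] (F : C ⥤ C') [F.Additive]
    [F.PreservesHomology] : (Der.map F).Additive := by
  let := HasDerivedCategory.standard C
  let := HasDerivedCategory.standard C'
  have := F.preservesFiniteLimits_of_preservesHomology
  have := F.preservesFiniteColimits_of_preservesHomology
  let F' : DerivedCategory C ⥤ DerivedCategory C' := Der.map F
  let W := HomologicalComplex.quasiIso C (ComplexShape.up ℤ)
  have : Localization.Lifting DerivedCategory.Q W (F.mapHomologicalComplex _ ⋙ DerivedCategory.Q)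
    F' := ⟨eqToIso (Der.fac F)⟩
  have e : F.mapDerivedCategory ≅ F' := Localization.liftNatIso DerivedCategory.Q W
    (F.mapHomologicalComplex _ ⋙ DerivedCategory.Q) (F.mapHomologicalComplex _ ⋙ DerivedCategory.Q)
    _ _ (Iso.refl _)
  have : F'.Additive := Functor.additive_of_iso e
  exact this

variable {G : Type t} [Group G] {A : Type u} [Category.{v} A] [Abelian A]

theorem isAdditivePresheaf_derRep : IsAdditivePresheaf (DerRep.{w} G A) :=
  ⟨fun X => (inferInstance : Preadditive (Der (RepCat A X))),
    fun X => (inferInstance : HasFiniteProducts (Der (RepCat A X))),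
    fun _ _ f => der_map_additive (repRes A f)⟩

theorem isStrictStack_derRep [Finite G] (p : ℕ) [Fact p.Prime] [Linear (ZLoc p) A] :
    IsStrictStack (DerRep.{w} G A) (sippTopology G p) :=
  fun _ _ _ hα => isEquivalence_comparison_derRep hα

end

end Sipp

universe w v u t

open CategoryTheory Limits in
theorem mainTheorem2 (p : ℕ) [Fact p.Prime] (G : Type t) [Group G] [Finite G] :
    (∀ (A : Type u) [Category.{v} A] [Preadditive A] [Linear (Sipp.ZLoc p) A]
        [HasFiniteProducts A] [IsIdempotentComplete A],
      Sipp.IsAdditivePresheaf (Sipp.Rep.{w} G A) ∧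
      Sipp.IsStrictStack (Sipp.Rep.{w} G A) (Sipp.sippTopology G p)) ∧
    (∀ (A : Type u) [Category.{v} A] [Abelian A] [Linear (Sipp.ZLoc p) A],
      Sipp.IsAdditivePresheaf (Sipp.DerRep.{w} G A) ∧
      Sipp.IsStrictStack (Sipp.DerRep.{w} G A) (Sipp.sippTopology G p)) ∧
    (∀ (k : Type u) [Field k] [CharP k p],
      Sipp.IsAdditivePresheaf (Sipp.StRep.{w} G k) ∧
      Sipp.IsStrictStack (Sipp.StRep.{w} G k) (Sipp.sippTopology G p)) := by
  exact
    ⟨fun A _ _ _ _ _ => ⟨Sipp.isAdditivePresheaf_rep, Sipp.isStrictStack_rep p⟩,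
      fun A _ _ _ => ⟨Sipp.isAdditivePresheaf_derRep, Sipp.isStrictStack_derRep p⟩,
      fun k _ _ => ⟨Sipp.isAdditivePresheaf_stRep, Sipp.isStrictStack_stRep p⟩⟩
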